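/- All graphs are finite and simple. $G+H$ and $G\oplus H$ denote the disjoint union and the join of $G$ and $H$, $\overline G$ is the complement of $G$, and $K_n$, $P_n$, $C_n$ are the complete graph, the path and the cycle on $n$ vertices; $2H=H+H$. For nonnegative integers $s,k$, a graph $G$ is *$(s,k)$-polar* if its vertex set has a partition $(A,B)$ (parts may be empty) such that $G[A]$ is a complete multipartite graph with at most $s$ parts and $G[B]$ is the complement of a complete multipartite graph with at most $k$ parts. A *minimal $(s,k)$-polar obstruction* is a graph that is not $(s,k)$-polar but all of whose proper induced subgraphs are. A graph is *$P_4$-sparse* if every set of at most five vertices induces at most one $P_4$. Let $\mathcal E$ be the set consisting of the seven graphs $$K_1+2K_2,\quad 2P_3,\quad C_4+2K_1,\quad K_1+\overline{P_3+K_2},\quad K_1+C_5,\quad K_1+P,\quad K_1+\overline{P_5},$$ where $P$ is $C_4$ with one pendant vertex attached; the first four of these are cographs and the last three are not. **Theorem.** Let $s\ge 2$ be an integer and let $G$ be a $P_4$-sparse graph. Then $G$ is a minimal $(s,1)$-polar obstruction if and only if $G$ satisfies exactly one of the following assertions: 1. $G$ is isomorphic to one of the four cographs $K_1+2K_2$,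 $2P_3$, $C_4+2K_1$, $K_1+\overline{P_3+K_2}$; 2. $G$ is isomorphic to $2K_{s+1}$, to $K_2+(K_s\oplus 2K_1)$, or to $K_1+(K_{s-1}\oplus C_4)$; 3. $\overline G$ is disconnected with connected components $G_1,\dots,G_t$, and there are nonnegative integers $s_1,\dots,s_t$ such that each $G_i$ is a minimal $(1,s_i)$-polar obstruction whose complement $\overline{G_i}$ is isomorphic to none of the seven graphs in $\mathcal E$, and $s=t-1+\sum_{i=1}^t s_i$. -/

import Mathlib

namespace PolarObs

open SimpleGraph

universe u v

/-- `G` is complete multipartite with at most `s` parts: the vertices can be distributed into `s`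
(possibly empty) classes so that two vertices are adjacent exactly when their classes differ. -/
def IsCompleteMultipartiteLE {V : Type u} (s : ℕ) (G : SimpleGraph V) : Prop :=
  ∃ f : V → Fin s, ∀ x y : V, G.Adj x y ↔ f x ≠ f y

/-- A `k`-cluster: the complement of a complete multipartite graph with at most `k` parts. -/
def IsCluster {V : Type u} (k : ℕ) (G : SimpleGraph V) : Prop :=
  IsCompleteMultipartiteLE k Gᶜ

/-- `G` is `(s, k)`-polar: its vertex set has a partition `(A, Aᶜ)` (parts may be empty) such that
`G[A]` is complete multipartite with at most `s` parts and `G[Aᶜ]` is a `k`-cluster. -/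
def IsPolar {V : Type u} (s k : ℕ) (G : SimpleGraph V) : Prop :=
  ∃ A : Set V, IsCompleteMultipartiteLE s (G.induce A) ∧ IsCluster k (G.induce Aᶜ)

/-- `G` is a minimal `(s, k)`-polar obstruction: it is not `(s, k)`-polar, but each of its proper
induced subgraphs is. -/
def IsMinimalPolarObstruction {V : Type u} (s k : ℕ) (G : SimpleGraph V) : Prop :=
  ¬ IsPolar s k G ∧ ∀ W : Set V, W ≠ Set.univ → IsPolar s k (G.induce W)

/-- The vertex set `X` induces a path on four vertices in `G`. -/
def InducesP4 {V : Type u} (G : SimpleGraph V) (X : Set V) : Prop :=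
  Nonempty (G.induce X ≃g pathGraph 4)

/-- `G` is `P₄`-sparse: any set of at most five vertices induces at most one `P₄`. -/
def IsP4Sparse {V : Type u} (G : SimpleGraph V) : Prop :=
  ∀ W : Finset V, W.card ≤ 5 → ∀ X Y : Set V, X ⊆ W → Y ⊆ W →
    InducesP4 G X → InducesP4 G Y → X = Y

/-- The join of two graphs: their disjoint union together with all edges between them. -/
def join {V : Type u} {W : Type v} (G : SimpleGraph V) (H : SimpleGraph W) :
    SimpleGraph (V ⊕ W) :=
  (G ⊕g H) ⊔ completeBipartiteGraph V W

/-- The complete graph `K_n`. -/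
abbrev K (n : ℕ) : SimpleGraph (Fin n) := completeGraph (Fin n)

/-- The edgeless graph `2 K₁`. -/
abbrev twoK1 : SimpleGraph (Fin 2) := ⊥

/-- The graph `P`: a cycle on four vertices with one pendant vertex attached. -/
def banner : SimpleGraph (Fin 5) :=
  fromEdgeSet {s(0, 1), s(1, 2), s(2, 3), s(3, 0), s(2, 4)}

/-- `K₁ + 2K₂` -/
abbrev E1 := K 1 ⊕g (K 2 ⊕g K 2)

/-- `2P₃` -/
abbrev E2 := pathGraph 3 ⊕g pathGraph 3

/-- `C₄ + 2K₁` -/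
abbrev E3 := cycleGraph 4 ⊕g twoK1

/-- `K₁` plus the complement of `P₃ + K₂` -/
abbrev E7 := K 1 ⊕g (pathGraph 3 ⊕g K 2)ᶜ

/-- `K₁ + C₅` -/
abbrev E10 := K 1 ⊕g cycleGraph 5

/-- `K₁ + P` -/
abbrev E11 := K 1 ⊕g banner

/-- `K₁` plus the complement of `P₅` -/
abbrev E12 := K 1 ⊕g (pathGraph 5)ᶜ

/-- `G` is isomorphic to one of the four cographs among the seven essential obstructions. -/
def IsEssentialCograph {V : Type u} (G : SimpleGraph V) : Prop :=
  Nonempty (G ≃g E1) ∨ Nonempty (G ≃g E2) ∨ Nonempty (G ≃g E3) ∨ Nonempty (G ≃g E7)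

/-- `G` is isomorphic to one of the seven essential obstructions. -/
def IsEssential {V : Type u} (G : SimpleGraph V) : Prop :=
  IsEssentialCograph G ∨
    Nonempty (G ≃g E10) ∨ Nonempty (G ≃g E11) ∨ Nonempty (G ≃g E12)

/-- `G` is isomorphic to `2K_{s+1}`, to `K₂ + (K_s ⊕ 2K₁)` or to `K₁ + (K_{s-1} ⊕ C₄)`
(used for `s ≥ 2`). -/
def IsDisconnectedType {V : Type u} (s : ℕ) (G : SimpleGraph V) : Prop :=
  Nonempty (G ≃g K (s + 1) ⊕g K (s + 1)) ∨
    Nonempty (G ≃g K 2 ⊕g join (K s) twoK1) ∨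
    Nonempty (G ≃g K 1 ⊕g join (K (s - 1)) (cycleGraph 4))

/-- The complement of `G` is disconnected, and its components can be listed without repetition as
`G₁, …, G_t` so that, for suitable natural numbers `s₁, …, s_t`, each `G_i` is a minimal
`(1, s_i)`-polar obstruction whose complement is not one of the seven essential obstructions, and
`s = t - 1 + ∑ s_i`. -/
def IsRecursiveType {V : Type u} (s : ℕ) (G : SimpleGraph V) : Prop :=
  ¬ Gᶜ.Preconnected ∧
    ∃ (t : ℕ) (C : Fin t ≃ Gᶜ.ConnectedComponent) (σ : Fin t → ℕ),
      (∀ i, IsMinimalPolarObstruction 1 (σ i) (C i).toSimpleGraph ∧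
        ¬ IsEssential (C i).toSimpleGraphᶜ) ∧
      (s : ℤ) = t - 1 + ∑ i, (σ i : ℤ)

/-- Exactly one of three propositions holds. -/
def ExactlyOne (p q r : Prop) : Prop :=
  (p ∧ ¬ q ∧ ¬ r) ∨ (¬ p ∧ q ∧ ¬ r) ∨ (¬ p ∧ ¬ q ∧ r)

end PolarObs

namespace PolarObs

open SimpleGraph

universe u v

/-! ### Polarity of vertex subsets -/

/-! The argument rests on a trichotomy. A `P₄`-sparse graph with at least two vertices is
disconnected, has disconnected complement, or is a spider, thin or with thin complement
(`Sparse.cut_or_spider`). A spider is never a minimal obstruction: once its body is removed, any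
polar partition of the rest puts a leg, now isolated, into the multipartite part. That part is then
independent, and the whole spider is a split graph. So a minimal obstruction is disconnected or
co-disconnected, and no graph is both.

In the disconnected case, every `P₄`-sparse graph that is not `(s, 1)`-polar contains one of seven
explicit graphs: the four essential cographs or the three graphs depending on `s`
(`exists_obstruction`). Each of the seven is itself a minimal obstruction, so a minimal obstruction
equals the one it contains.

In the co-disconnected case, `G` is the join of the subgraphs induced by its co-components. The
parts of a complete multipartite set inside a join are distributed among the factors, so the least
number of parts needed is additive. Hence `G` is a minimal obstruction exactly when these numbers `m
i` sum to `s + 1` and every vertex deletion lowers the number of its factor. Each factor is then a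
minimal `(m i - 1, 1)`-polar obstruction, and `s_i = m i - 1` gives the formula for `s`. The
delicate point is that the sum cannot exceed `s + 1`: by `IsMinimalPolarObstruction.polarOn_succ`, a
co-connected minimal obstruction needs only one extra part, unless it is an essential cograph, which
no number of parts makes polar. Complementation turns `(s_i, 1)` into `(1, s_i)`, the form used for
the components of the complement. The three essential graphs that are not cographs never arise,
since they are not `P₄`-sparse. -/

/-- The subgraph of `G` induced by `W` is `(s, 1)`-polar, witnessed by a set `A` and a colouring
of the vertices by natural numbers. -/
def PolarOn {V : Type u} (G : SimpleGraph V) (s : ℕ) (W : Set V) : Prop :=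
  ∃ (A : Set V) (f : V → ℕ), (∀ x ∈ W, x ∈ A → f x < s) ∧
    (∀ x ∈ W, x ∈ A → ∀ y ∈ W, y ∈ A → (G.Adj x y ↔ f x ≠ f y)) ∧
    ∀ x ∈ W, x ∉ A → ∀ y ∈ W, y ∉ A → x ≠ y → G.Adj x y

variable {V : Type u} {V' : Type v} {G : SimpleGraph V} {H : SimpleGraph V'} {s : ℕ}

/-- Only the number of colours matters, so parts may be labelled by whatever type is convenient:
cliques, sums, options. -/
theorem PolarOn.of_colouring {α : Type*} {W : Set V} (A : Set V) (T : Finset α) (f : V → α)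
    (hT : T.card ≤ s) (hf : ∀ x ∈ W, x ∈ A → f x ∈ T)
    (hA : ∀ x ∈ W, x ∈ A → ∀ y ∈ W, y ∈ A → (G.Adj x y ↔ f x ≠ f y))
    (hB : ∀ x ∈ W, x ∉ A → ∀ y ∈ W, y ∉ A → x ≠ y → G.Adj x y) : PolarOn G s W := by
  classical
  refine ⟨A, fun x => if h : f x ∈ T then T.equivFin ⟨f x, h⟩ else 0, ?_, ?_, hB⟩
  · intro x hx hxA
    simp only [hf x hx hxA, dite_true]
    exact (T.equivFin _).2.trans_le hT
  · intro x hx hxA y hy hyA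
    simp only [hf x hx hxA, hf y hy hyA, dite_true]
    rw [hA x hx hxA y hy hyA, Ne, Ne, Fin.val_inj, T.equivFin.apply_eq_iff_eq, Subtype.mk.injEq]

theorem PolarOn.mono {W W' : Set V} (h : PolarOn G s W) (hW : W' ⊆ W) : PolarOn G s W' := by
  obtain ⟨A, f, h1, h2, h3⟩ := h
  exact ⟨A, f, fun x hx => h1 x (hW hx), fun x hx hxA y hy => h2 x (hW hx) hxA y (hW hy),
    fun x hx hxA y hy => h3 x (hW hx) hxA y (hW hy)⟩

theorem PolarOn.mono_right {W : Set V} {r : ℕ} (h : PolarOn G s W) (hr : s ≤ r) :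
    PolarOn G r W := by
  obtain ⟨A, f, h1, h2, h3⟩ := h
  exact ⟨A, f, fun x hx hxA => (h1 x hx hxA).trans_le hr, h2, h3⟩

theorem PolarOn.comap (φ : H ↪g G) {W : Set V'} {W' : Set V} (hW : ∀ x ∈ W, φ x ∈ W')
    (h : PolarOn G s W') : PolarOn H s W := by
  obtain ⟨A, f, h1, h2, h3⟩ := h
  refine ⟨φ ⁻¹' A, f ∘ φ, fun x hx hxA => h1 _ (hW x hx) hxA, fun x hx hxA y hy hyA => ?_,
    fun x hx hxA y hy hyA hxy => ?_⟩
  · rw [← φ.map_adj_iff]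
    exact h2 _ (hW x hx) hxA _ (hW y hy) hyA
  · rw [← φ.map_adj_iff]
    exact h3 _ (hW x hx) hxA _ (hW y hy) hyA (φ.injective.ne hxy)

theorem PolarOn.of_image (φ : H ↪g G) {W : Set V'} (h : PolarOn H s W) :
    PolarOn G s (φ '' W) := by
  classical
  obtain ⟨A, f, h1, h2, h3⟩ := h
  refine ⟨φ '' A, Function.extend φ f 0, ?_, ?_, ?_⟩
  · rintro _ ⟨x, hx, rfl⟩ hxA
    rw [φ.injective.mem_set_image] at hxA
    rw [φ.injective.extend_apply]
    exact h1 x hx hxA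
  · rintro _ ⟨x, hx, rfl⟩ hxA _ ⟨y, hy, rfl⟩ hyA
    rw [φ.injective.mem_set_image] at hxA hyA
    rw [φ.injective.extend_apply, φ.injective.extend_apply, φ.map_adj_iff]
    exact h2 x hx hxA y hy hyA
  · rintro _ ⟨x, hx, rfl⟩ hxA _ ⟨y, hy, rfl⟩ hyA hxy
    rw [φ.injective.mem_set_image] at hxA hyA
    rw [φ.map_adj_iff]
    exact h3 x hx hxA y hy hyA (ne_of_apply_ne _ hxy)

theorem polarOn_image_iff (φ : H ↪g G) {W : Set V'} : PolarOn G s (φ '' W) ↔ PolarOn H s W :=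
  ⟨fun h => h.comap φ fun _ hx => Set.mem_image_of_mem _ hx, fun h => h.of_image φ⟩

theorem isPolar_iff_polarOn_univ : IsPolar s 1 G ↔ PolarOn G s Set.univ := by
  classical
  constructor
  · rintro ⟨A, ⟨f, hf⟩, g, hg⟩
    refine ⟨A, fun x => if h : x ∈ A then f ⟨x, h⟩ else 0, ?_, ?_, ?_⟩
    · intro x _ hx
      simp [hx]
    · intro x _ hx y _ hy
      have := hf ⟨x, hx⟩ ⟨y, hy⟩
      simpa [hx, hy, Fin.ext_iff] using this
    · intro x _ hx y _ hy hxy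
      have := hg ⟨x, hx⟩ ⟨y, hy⟩
      rw [Subsingleton.elim (g ⟨x, hx⟩) (g ⟨y, hy⟩)] at this
      by_contra hn
      simp [hxy, hn] at this
  · rintro ⟨A, f, h1, h2, h3⟩
    refine ⟨A, ⟨fun x => ⟨f x, h1 x trivial x.2⟩, fun x y => ?_⟩, fun _ => 0, fun x y => ?_⟩
    · simpa using h2 x trivial x.2 y trivial y.2
    · simp only [compl_adj, comap_adj, ne_eq, not_true, iff_false, not_and, not_not]
      intro hxy
      exact h3 x trivial x.2 y trivial y.2 (fun h => hxy (Subtype.ext h))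

theorem isPolar_induce_iff {W : Set V} : IsPolar s 1 (G.induce W) ↔ PolarOn G s W := by
  rw [isPolar_iff_polarOn_univ, ← polarOn_image_iff (Embedding.induce W)]
  have : (Embedding.induce W : G.induce W ↪g G) '' Set.univ = W := by
    ext x; simp
  rw [this]

theorem isMinimalPolarObstruction_iff : IsMinimalPolarObstruction s 1 G ↔
    ¬ PolarOn G s Set.univ ∧ ∀ W : Set V, W ≠ Set.univ → PolarOn G s W := by
  simp only [IsMinimalPolarObstruction, isPolar_iff_polarOn_univ (G := G), isPolar_induce_iff]

/-- To check minimality it suffices to delete single vertices. -/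
theorem isMinimalPolarObstruction_of_delete (h : ¬ PolarOn G s Set.univ)
    (h' : ∀ v : V, PolarOn G s {v}ᶜ) : IsMinimalPolarObstruction s 1 G := by
  rw [isMinimalPolarObstruction_iff]
  refine ⟨h, fun W hW => ?_⟩
  obtain ⟨v, hv⟩ := (Set.ne_univ_iff_exists_notMem W).1 hW
  exact (h' v).mono fun x hx => by rintro rfl; exact hv hx

theorem IsMinimalPolarObstruction.polarOn_of_notMem (h : IsMinimalPolarObstruction s 1 G)
    {W : Set V} {v : V} (hv : v ∉ W) : PolarOn G s W :=
  (isMinimalPolarObstruction_iff.1 h).2 W fun hW => hv (hW ▸ trivial)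

theorem PolarOn.of_embedding (φ : H ↪g G) (h : PolarOn G s Set.univ) :
    PolarOn H s Set.univ :=
  h.comap (W' := Set.univ) φ fun _ _ => trivial

theorem isMinimalPolarObstruction_of_iso (e : G ≃g H) (h : IsMinimalPolarObstruction s 1 H) :
    IsMinimalPolarObstruction s 1 G := by
  rw [isMinimalPolarObstruction_iff] at h ⊢
  refine ⟨fun hG => h.1 (hG.of_embedding e.symm.toEmbedding), fun W hW => ?_⟩
  rw [← polarOn_image_iff e.toEmbedding]
  refine h.2 _ fun hu => hW ?_
  ext x
  have : e x ∈ e.toEmbedding '' W := hu ▸ trivial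
  obtain ⟨y, hy, hxy⟩ := this
  rw [← e.injective hxy]
  simpa using hy

/-- A minimal obstruction is isomorphic to each obstruction embedded in it. -/
theorem IsMinimalPolarObstruction.nonempty_iso (h : IsMinimalPolarObstruction s 1 G) (φ : H ↪g G)
    (hH : ¬ PolarOn H s Set.univ) : Nonempty (G ≃g H) := by
  rw [isMinimalPolarObstruction_iff] at h
  have hs : Function.Surjective φ := by
    by_contra hn
    apply hH
    rw [← polarOn_image_iff φ, Set.image_univ]
    exact h.2 _ fun hu => hn (Set.range_eq_univ.1 hu)
  exact ⟨(⟨Equiv.ofBijective φ ⟨φ.injective, hs⟩, φ.map_adj_iff⟩ : H ≃g G).symm⟩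

/-! ### Complements -/

theorem induce_compl_eq (W : Set V) : Gᶜ.induce W = (G.induce W)ᶜ := by
  ext x y
  simp [Subtype.ext_iff]

/-- Complementation exchanges complete multipartite graphs with clusters, so the two sides of the
partition swap. -/
theorem isPolar_compl_iff {k : ℕ} : IsPolar s k Gᶜ ↔ IsPolar k s G := by
  suffices h : ∀ (s k : ℕ) (G : SimpleGraph V), IsPolar s k G → IsPolar k s Gᶜ by
    exact ⟨fun hG => by simpa using h _ _ _ hG, h _ _ _⟩
  rintro s k G ⟨A, hA, hB⟩
  refine ⟨Aᶜ, ?_, ?_⟩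
  · rw [induce_compl_eq]
    exact hB
  · rw [IsCluster, induce_compl_eq, compl_compl, compl_compl]
    exact hA

theorem isMinimalPolarObstruction_compl_iff {k : ℕ} :
    IsMinimalPolarObstruction s k Gᶜ ↔ IsMinimalPolarObstruction k s G := by
  simp only [IsMinimalPolarObstruction, induce_compl_eq, isPolar_compl_iff]

/-! ### Joins -/

/-- Tagging each colour with its factor keeps the palettes disjoint, as the edges between factors
require; the clique parts of the factors unite to a clique. -/
theorem PolarOn.join {ι : Type*} [Fintype ι] (c : V → ι) (hc : ∀ x y, c x ≠ c y → G.Adj x y)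
    (W : Set V) (m : ι → ℕ) (h : ∀ i, PolarOn G (m i) (W ∩ c ⁻¹' {i})) :
    PolarOn G (∑ i, m i) W := by
  classical
  choose A f h1 h2 h3 using h
  have key : ∀ x ∈ W, ∀ i, c x = i → x ∈ W ∩ c ⁻¹' {i} := fun x hx i hi => ⟨hx, hi⟩
  refine PolarOn.of_colouring {x | x ∈ A (c x)}
    (Finset.univ.sigma fun i => Finset.range (m i)) (fun x => (⟨c x, f (c x) x⟩ : Σ _ : ι, ℕ))
    ?_ ?_ ?_ ?_
  · simp
  · intro x hx hxA
    simpa using h1 _ x (key x hx _ rfl) hxA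
  · intro x hx hxA y hy hyA
    by_cases hxy : c x = c y
    · have hyA' : y ∈ A (c x) := by rw [hxy]; exact hyA
      simpa [hxy] using h2 (c x) x (key x hx _ rfl) hxA y (key y hy _ hxy.symm) hyA'
    · simp [hxy, hc x y hxy]
  · intro x hx hxA y hy hyA hne
    by_cases hxy : c x = c y
    · have hyA' : y ∉ A (c x) := by rw [hxy]; exact hyA
      exact h3 (c x) x (key x hx _ rfl) hxA y (key y hy _ hxy.symm) hyA' hne
    · exact hc x y hxy

/-- Vertices in different factors are adjacent and so have different colours. The palettes `T i`
used by the factors are therefore disjoint, and their sizes add up to at most `s`. -/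
theorem PolarOn.exists_of_join [Finite V] {ι : Type*} [Fintype ι] (c : V → ι)
    (hc : ∀ x y, c x ≠ c y → G.Adj x y) {W : Set V} (h : PolarOn G s W) :
    ∃ m : ι → ℕ, ∑ i, m i ≤ s ∧ ∀ i, PolarOn G (m i) (W ∩ c ⁻¹' {i}) := by
  classical
  have := Fintype.ofFinite V
  obtain ⟨A, f, h1, h2, h3⟩ := h
  let T : ι → Finset ℕ := fun i => (Finset.univ.filter fun x => x ∈ W ∧ x ∈ A ∧ c x = i).image f
  refine ⟨fun i => (T i).card, ?_, fun i => ?_⟩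
  · rw [← Finset.card_biUnion]
    · calc _ ≤ (Finset.range s).card := by
            refine Finset.card_le_card fun n hn => ?_
            simp only [T, Finset.mem_biUnion, Finset.mem_image, Finset.mem_filter,
              Finset.mem_univ, true_and] at hn
            obtain ⟨i, x, ⟨hx, hxA, -⟩, rfl⟩ := hn
            exact Finset.mem_range.2 (h1 x hx hxA)
        _ = s := Finset.card_range s
    · intro i _ j _ hij
      rw [Function.onFun, Finset.disjoint_left]
      intro n hn hn'
      simp only [T, Finset.mem_image, Finset.mem_filter, Finset.mem_univ, true_and] at hn hn'
      obtain ⟨x, ⟨hx, hxA, rfl⟩, rfl⟩ := hn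
      obtain ⟨y, ⟨hy, hyA, rfl⟩, hxy⟩ := hn'
      exact (h2 x hx hxA y hy hyA).1 (hc x y hij) hxy.symm
  · refine PolarOn.of_colouring A (T i) f le_rfl ?_ ?_ ?_
    · rintro x ⟨hx, hxi⟩ hxA
      exact Finset.mem_image_of_mem f (by simpa using ⟨hx, hxA, hxi⟩)
    · exact fun x hx hxA y hy hyA => h2 x hx.1 hxA y hy.1 hyA
    · exact fun x hx hxA y hy hyA => h3 x hx.1 hxA y hy.1 hyA

/-! ### `P₄`-sparse graphs -/

/-- `a, b, c, d` induce a path in this order. -/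
def IsP4 (G : SimpleGraph V) (a b c d : V) : Prop :=
  G.Adj a b ∧ G.Adj b c ∧ G.Adj c d ∧ ¬ G.Adj a c ∧ ¬ G.Adj b d ∧ ¬ G.Adj a d

/-- Each vertex outside an induced `P₄` is adjacent to none of its vertices, to all of them, or to
exactly the two midpoints. -/
def Sparse (G : SimpleGraph V) : Prop :=
  ∀ a b c d x : V, IsP4 G a b c d → x ≠ a → x ≠ b → x ≠ c → x ≠ d →
    (¬ G.Adj x a ∧ ¬ G.Adj x b ∧ ¬ G.Adj x c ∧ ¬ G.Adj x d) ∨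
    (G.Adj x a ∧ G.Adj x b ∧ G.Adj x c ∧ G.Adj x d) ∨
    (¬ G.Adj x a ∧ G.Adj x b ∧ G.Adj x c ∧ ¬ G.Adj x d)

theorem IsP4.ne {a b c d : V} (h : IsP4 G a b c d) :
    a ≠ b ∧ a ≠ c ∧ a ≠ d ∧ b ≠ c ∧ b ≠ d ∧ c ≠ d := by
  obtain ⟨h1, h2, h3, h4, h5, h6⟩ := h
  refine ⟨h1.ne, ?_, ?_, h2.ne, ?_, h3.ne⟩
  · rintro rfl; exact h6 h3
  · rintro rfl; exact h5 h1.symm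
  · rintro rfl; exact h6 h1

theorem IsP4.inducesP4 {a b c d : V} (h : IsP4 G a b c d) : InducesP4 G {a, b, c, d} := by
  have hn := h.ne
  obtain ⟨h1, h2, h3, h4, h5, h6⟩ := h
  have hinj : Function.Injective ![a, b, c, d] := by
    intro i j hij
    fin_cases i <;> fin_cases j <;> simp_all
  have hr : Set.range ![a, b, c, d] = {a, b, c, d} := by
    ext x
    simp [eq_comm]
    tauto
  rw [← hr]
  refine ⟨((⟨Equiv.ofInjective _ hinj, ?_⟩ :
    pathGraph 4 ≃g G.induce (Set.range ![a, b, c, d]))).symm⟩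
  intro i j
  fin_cases i <;> fin_cases j <;> simp_all [pathGraph_adj, G.adj_comm]

/-- With any other neighbourhood on the path, `x` together with three of its vertices would form a
second `P₄` among the five. -/
theorem IsP4Sparse.sparse (hG : IsP4Sparse G) : Sparse G := by
  classical
  intro a b c d x h hxa hxb hxc hxd
  have key : ∀ p q r t : V, IsP4 G p q r t → (x = p ∨ x = q ∨ x = r ∨ x = t) →
      (p ∈ ({a, b, c, d, x} : Finset V) ∧ q ∈ ({a, b, c, d, x} : Finset V) ∧
        r ∈ ({a, b, c, d, x} : Finset V) ∧ t ∈ ({a, b, c, d, x} : Finset V)) → False := by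
    rintro p q r t h' hx ⟨hp, hq, hr, ht⟩
    have := hG {a, b, c, d, x} Finset.card_le_five {a, b, c, d} {p, q, r, t} ?_ ?_
      h.inducesP4 h'.inducesP4
    · have hx' : x ∈ ({p, q, r, t} : Set V) := by simpa using hx
      rw [← this] at hx'
      simp [hxa, hxb, hxc, hxd] at hx'
    · intro y hy
      simp only [Set.mem_insert_iff, Set.mem_singleton_iff] at hy
      simp only [Finset.coe_insert, Finset.coe_singleton, Set.mem_insert_iff,
        Set.mem_singleton_iff]
      tauto
    · intro y hy
      simp only [Set.mem_insert_iff, Set.mem_singleton_iff] at hy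
      rcases hy with rfl | rfl | rfl | rfl <;> assumption
  obtain ⟨h1, h2, h3, h4, h5, h6⟩ := h
  have e1 := h1.symm
  have e2 := h2.symm
  have e3 := h3.symm
  have e4 : ¬ G.Adj c a := fun h => h4 h.symm
  have e5 : ¬ G.Adj d b := fun h => h5 h.symm
  have e6 : ¬ G.Adj d a := fun h => h6 h.symm
  -- These candidate paths cover the thirteen neighbourhoods of `x` other than the empty one, the
  -- full one and the two midpoints.
  have k1 := key x a b c
  have k2 := key x b c d
  have k3 := key x c b a
  have k4 := key x d c b
  have k5 := key d c x a
  have k6 := key a b x d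
  have k7 := key a x c d
  have k8 := key a x d c
  have k9 := key d x a b
  simp only [IsP4, Finset.mem_insert, Finset.mem_singleton, true_or, or_true, and_true,
    true_and, G.adj_comm _ x, h1, h2, h3, h4, h5, h6, e1, e2, e3, e4, e5, e6, not_false_iff, forall_const, imp_false] at k1 k2 k3 k4 k5 k6 k7 k8 k9
  clear key hG
  clear h1 h2 h3 h4 h5 h6 e1 e2 e3 e4 e5 e6
  grind

theorem Sparse.comap (hG : Sparse G) (φ : H ↪g G) : Sparse H := by
  intro a b c d x h h1 h2 h3 h4
  have := hG (φ a) (φ b) (φ c) (φ d) (φ x) (by simpa only [IsP4, φ.map_adj_iff] using h)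
    (φ.injective.ne h1) (φ.injective.ne h2) (φ.injective.ne h3) (φ.injective.ne h4)
  simpa only [φ.map_adj_iff] using this

/-- The complement of the path `a b c d` is the path `b d a c`. Ends and midpoints are exchanged, so
being adjacent to exactly the midpoints is self-complementary. -/
theorem Sparse.compl (hG : Sparse G) : Sparse Gᶜ := by
  intro a b c d x h h1 h2 h3 h4
  have hn := h.ne
  have hP : IsP4 G b d a c := by
    simp only [IsP4, compl_adj] at h ⊢
    refine ⟨?_, ?_, ?_, ?_, ?_, ?_⟩ <;> simp_all [G.adj_comm]
  have := hG b d a c x hP h2 h4 h1 h3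
  simp only [compl_adj]
  tauto

/-! ### Disconnected vertex sets and spiders -/

/-- `W` splits into two nonempty parts without edges between them. -/
def Cut (G : SimpleGraph V) (W : Set V) : Prop :=
  ∃ X : Set V, (∃ x ∈ W, x ∈ X) ∧ (∃ y ∈ W, y ∉ X) ∧
    ∀ x ∈ W, x ∈ X → ∀ y ∈ W, y ∉ X → ¬ G.Adj x y

/-- `W` induces a thin spider with legs `S`, body `K`, and head `W \ (S ∪ K)`. -/
structure IsThinSpider (G : SimpleGraph V) (W S K : Set V) : Prop where
  legs_subset : S ⊆ W
  body_subset : K ⊆ W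
  disjoint : ∀ x ∈ S, x ∉ K
  nontrivial : ∃ x ∈ S, ∃ y ∈ S, x ≠ y
  indep : ∀ x ∈ S, ∀ y ∈ S, ¬ G.Adj x y
  clique : ∀ x ∈ K, ∀ y ∈ K, x ≠ y → G.Adj x y
  exists_body : ∀ x ∈ S, ∃ y ∈ K, G.Adj x y
  exists_leg : ∀ y ∈ K, ∃ x ∈ S, G.Adj x y
  body_unique : ∀ x ∈ S, ∀ y ∈ K, ∀ y' ∈ K, G.Adj x y → G.Adj x y' → y = y'
  leg_unique : ∀ y ∈ K, ∀ x ∈ S, ∀ x' ∈ S, G.Adj x y → G.Adj x' y → x = x'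
  head_body : ∀ x ∈ W, x ∉ S → x ∉ K → ∀ y ∈ K, G.Adj x y
  head_legs : ∀ x ∈ W, x ∉ S → x ∉ K → ∀ y ∈ S, ¬ G.Adj x y

/-- Here `v` is a cut vertex, with a non-neighbour on the side `X`. Connectedness yields paths `u w
v z` with `u, w` in `X` and `z` on the other side; `Sparse`, applied to all such paths, forces the
spider. -/
theorem exists_thinSpider_of_cut (hG : Sparse G) {W X : Set V} {v : V} (hv : v ∈ W) (hvX : v ∉ X)
    (hX : ∃ x ∈ W, x ∈ X ∧ ¬ G.Adj v x) (hY : ∃ y ∈ W, y ≠ v ∧ y ∉ X)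
    (hXY : ∀ x ∈ W, x ∈ X → ∀ y ∈ W, y ≠ v → y ∉ X → ¬ G.Adj x y) (h1 : ¬ Cut G W) :
    ∃ S K, IsThinSpider G W S K := by
  have hcut : ∀ X : Set V, (∃ x ∈ W, x ∈ X) → (∃ y ∈ W, y ∉ X) →
      ∃ x ∈ W, x ∈ X ∧ ∃ y ∈ W, y ∉ X ∧ G.Adj x y := by
    intro X hx hy
    by_contra hn
    exact h1 ⟨X, hx, hy, fun x hx hxX y hy hyX hxy => hn ⟨x, hx, hxX, y, hy, hyX, hxy⟩⟩
  have hXY' : ∀ x ∈ W, x ∈ X → ∀ y ∈ W, y ≠ v → y ∉ X → ¬ G.Adj y x :=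
    fun x hx hxX y hy hyv hyX h => hXY x hx hxX y hy hyv hyX h.symm
  obtain ⟨u, hu, huX, w, hw, hwX, huv, huw, hwv⟩ : ∃ u ∈ W, u ∈ X ∧ ∃ w ∈ W, w ∈ X ∧
      ¬ G.Adj v u ∧ G.Adj u w ∧ G.Adj v w := by
    obtain ⟨x, hx, hxX, hxv⟩ := hX
    obtain ⟨u, hu, ⟨huX, huv⟩, w, hw, hw', huw⟩ :=
      hcut {x | x ∈ X ∧ ¬ G.Adj v x} ⟨x, hx, hxX, hxv⟩ ⟨v, hv, fun h => hvX h.1⟩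
    have hwv : w ≠ v := by rintro rfl; exact huv huw.symm
    have hwX : w ∈ X := by
      by_contra hwX
      exact hXY u hu huX w hw hwv hwX huw
    refine ⟨u, hu, huX, w, hw, hwX, huv, huw, ?_⟩
    by_contra hn
    exact hw' ⟨hwX, hn⟩
  obtain ⟨z, hz, hzv, hzX, hvz⟩ : ∃ z ∈ W, z ≠ v ∧ z ∉ X ∧ G.Adj v z := by
    obtain ⟨y, hy, hyv, hyX⟩ := hY
    obtain ⟨z, hz, ⟨hzv, hzX⟩, t, ht, ht', hzt⟩ :=
      hcut {y | y ≠ v ∧ y ∉ X} ⟨y, hy, hyv, hyX⟩ ⟨v, hv, fun h => h.1 rfl⟩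
    have : t = v := by
      by_contra htv
      have htX : t ∈ X := by
        by_contra htX
        exact ht' ⟨htv, htX⟩
      exact hXY t ht htX z hz hzv hzX hzt.symm
    subst this
    exact ⟨z, hz, hzv, hzX, hzt.symm⟩
  have hne : ∀ x ∈ X, ∀ y, y ∉ X → x ≠ y := by
    rintro x hx y hy rfl
    exact hy hx
  have hP : ∀ u ∈ W, u ∈ X → ∀ w ∈ W, w ∈ X → ¬ G.Adj v u → G.Adj u w → G.Adj v w →
      IsP4 G u w v z := fun u hu huX w hw hwX huv huw hwv =>
    ⟨huw, hwv.symm, hvz, fun h => huv h.symm, hXY w hw hwX z hz hzv hzX,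
      hXY u hu huX z hz hzv hzX⟩
  -- Another vertex `y` beyond `v` misses `w`, hence misses the whole path. All such vertices
  -- together would be cut off from the rest.
  have hz_only : ∀ y ∈ W, y ≠ v → y ∉ X → y = z := by
    by_contra! hn
    obtain ⟨y, hy, hyv, hyX, hyz⟩ := hn
    have hN : ∀ y ∈ W, y ≠ v → y ∉ X → y ≠ z → ¬ G.Adj y v ∧ ¬ G.Adj y z := by
      intro y hy hyv hyX hyz
      have := hG u w v z y (hP u hu huX w hw hwX huv huw hwv) (hne u huX y hyX).symm
        (hne w hwX y hyX).symm hyv hyz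
      have := hXY' w hw hwX y hy hyv hyX
      tauto
    obtain ⟨x, hx, ⟨hxv, hxX, hxz⟩, t, ht, ht', hxt⟩ :=
      hcut {y | y ≠ v ∧ y ∉ X ∧ y ≠ z} ⟨y, hy, hyv, hyX, hyz⟩ ⟨v, hv, fun h => h.1 rfl⟩
    obtain ⟨hxv', hxz'⟩ := hN x hx hxv hxX hxz
    have htv : t ≠ v := by rintro rfl; exact hxv' hxt
    have htz : t ≠ z := by rintro rfl; exact hxz' hxt
    have htX : t ∈ X := by
      by_contra htX
      exact ht' ⟨htv, htX, htz⟩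
    exact hXY t ht htX x hx hxv hxX hxt.symm
  have hzx : ∀ x ∈ W, x ∈ X → ¬ G.Adj x z := fun x hx hxX => hXY x hx hxX z hz hzv hzX
  have hzx' : ∀ x ∈ W, x ∈ X → ¬ G.Adj z x := fun x hx hxX h => hzx x hx hxX h.symm
  -- A vertex of `X` misses the end `z`, so on the path `u w v z` it sees nothing or exactly `w` and
  -- `v`.
  have hleg : ∀ u ∈ W, u ∈ X → ∀ w ∈ W, w ∈ X → ¬ G.Adj v u → G.Adj u w → G.Adj v w →
      ∀ y ∈ W, y ∈ X → y ≠ u → y ≠ w → ¬ G.Adj y u ∧ (G.Adj v y ↔ G.Adj y w) := by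
    intro u hu huX w hw hwX huv huw hwv y hy hyX hyu hyw
    have := hG u w v z y (hP u hu huX w hw hwX huv huw hwv) hyu hyw (hne y hyX v hvX)
      (hne y hyX z hzX)
    have h2 := hzx y hy hyX
    rw [G.adj_comm v y]
    tauto
  have hbody : ∀ u ∈ W, u ∈ X → ¬ G.Adj v u → ∃ w ∈ W, w ∈ X ∧ G.Adj v w ∧ G.Adj u w := by
    by_contra! hn
    obtain ⟨u₀, hu₀, huX₀, huv₀, hu₀'⟩ := hn
    obtain ⟨x, hx, ⟨hxX, hxv, hxw⟩, t, ht, ht', hxt⟩ :=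
      hcut {u | u ∈ X ∧ ¬ G.Adj v u ∧ ∀ w ∈ W, w ∈ X → G.Adj v w → ¬ G.Adj u w}
        ⟨u₀, hu₀, huX₀, huv₀, hu₀'⟩ ⟨v, hv, fun h => hvX h.1⟩
    have htv : t ≠ v := by rintro rfl; exact hxv hxt.symm
    have htX : t ∈ X := by
      by_contra htX
      exact hXY x hx hxX t ht htv htX hxt
    have htv' : ¬ G.Adj v t := fun h => hxw t ht htX h hxt
    have : ∃ w ∈ W, w ∈ X ∧ G.Adj v w ∧ G.Adj t w := by
      by_contra! hn
      exact ht' ⟨htX, htv', hn⟩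
    obtain ⟨w, hw, hwX, hvw, htw⟩ := this
    refine (hleg t ht htX w hw hwX htv' htw hvw x hx hxX hxt.ne ?_).1 hxt
    rintro rfl
    exact hxv hvw
  -- The legs are `z` and the non-neighbours of `v` in `X`; the body is `v` and the neighbours of
  -- these legs in `X`; the head is what remains of the neighbourhood of `v` in `X`.
  refine ⟨{x | x ∈ W ∧ (x = z ∨ x ∈ X ∧ ¬ G.Adj v x)},
    {x | x ∈ W ∧ (x = v ∨ x ∈ X ∧ G.Adj v x ∧ ∃ u ∈ W, u ∈ X ∧ ¬ G.Adj v u ∧ G.Adj u x)},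
    fun x hx => hx.1, fun x hx => hx.1, ?_, ?_, ?_, ?_, ?_, ?_, ?_, ?_, ?_, ?_⟩
  · rintro x ⟨-, rfl | ⟨hx, hxv⟩⟩ ⟨-, rfl | ⟨hx', hx'', -⟩⟩
    · exact hzv rfl
    · exact hzX hx'
    · exact hvX hx
    · exact hxv hx''
  · exact ⟨u, ⟨hu, Or.inr ⟨huX, huv⟩⟩, z, ⟨hz, Or.inl rfl⟩, hne u huX z hzX⟩
  · rintro x ⟨hx, rfl | ⟨hxX, hxv⟩⟩ y ⟨hy, rfl | ⟨hyX, hyv⟩⟩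
    · exact G.loopless.irrefl _
    · exact hzx' y hy hyX
    · exact hzx x hx hxX
    · obtain ⟨w, hw, hwX, hvw, hyw⟩ := hbody y hy hyX hyv
      intro hxy
      refine (hleg y hy hyX w hw hwX hyv hyw hvw x hx hxX hxy.ne ?_).1 hxy
      rintro rfl
      exact hxv hvw
  · rintro x ⟨hx, rfl | ⟨hxX, hvx, -⟩⟩ y ⟨hy, rfl | ⟨hyX, hvy, t, ht, htX, hvt, hty⟩⟩ hxy
    · exact absurd rfl hxy
    · exact hvy
    · exact hvx.symm
    · exact (hleg t ht htX y hy hyX hvt hty hvy x hx hxX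
        (by rintro rfl; exact hvt hvx) hxy).2.1 hvx
  · rintro x ⟨hx, rfl | ⟨hxX, hxv⟩⟩
    · exact ⟨v, ⟨hv, Or.inl rfl⟩, hvz.symm⟩
    · obtain ⟨w, hw, hwX, hvw, hxw⟩ := hbody x hx hxX hxv
      exact ⟨w, ⟨hw, Or.inr ⟨hwX, hvw, x, hx, hxX, hxv, hxw⟩⟩, hxw⟩
  · rintro y ⟨hy, rfl | ⟨hyX, hvy, t, ht, htX, hvt, hty⟩⟩
    · exact ⟨z, ⟨hz, Or.inl rfl⟩, hvz.symm⟩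
    · exact ⟨t, ⟨ht, Or.inr ⟨htX, hvt⟩⟩, hty⟩
  · rintro x ⟨hx, rfl | ⟨hxX, hxv⟩⟩ y ⟨hy, rfl | ⟨hyX, hvy, -⟩⟩ y' ⟨hy', rfl | ⟨hyX', hvy', -⟩⟩
      hxy hxy'
    · rfl
    · exact absurd hxy' (hzx' y' hy' hyX')
    · exact absurd hxy (hzx' y hy hyX)
    · exact absurd hxy (hzx' y hy hyX)
    · rfl
    · exact absurd hxy.symm hxv
    · exact absurd hxy'.symm hxv
    · by_contra hne'
      exact (hleg x hx hxX y hy hyX hxv hxy hvy y' hy' hyX' hxy'.ne' (Ne.symm hne')).1 hxy'.symm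
  · rintro y ⟨hy, rfl | ⟨hyX, hvy, -⟩⟩ x ⟨hx, rfl | ⟨hxX, hxv⟩⟩ x' ⟨hx', rfl | ⟨hxX', hxv'⟩⟩
      hxy hxy'
    · rfl
    · exact absurd hxy'.symm hxv'
    · exact absurd hxy.symm hxv
    · exact absurd hxy.symm hxv
    · rfl
    · exact absurd hxy (hzx' y hy hyX)
    · exact absurd hxy' (hzx' y hy hyX)
    · by_contra hne'
      have := (hleg x hx hxX y hy hyX hxv hxy hvy x' hx' hxX' (Ne.symm hne')
        (by rintro rfl; exact hxv' hvy)).2.2 hxy'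
      exact hxv' this
  · rintro x hx hxS hxK y ⟨hy, rfl | ⟨hyX, hvy, t, ht, htX, hvt, hty⟩⟩
    · have hxX : x ∈ X := by
        by_contra hxX
        exact hxS ⟨hx, Or.inl (hz_only x hx (fun h => hxK ⟨hx, Or.inl h⟩) hxX)⟩
      by_contra hn
      exact hxS ⟨hx, Or.inr ⟨hxX, fun h => hn h.symm⟩⟩
    · have hxX : x ∈ X := by
        by_contra hxX
        exact hxS ⟨hx, Or.inl (hz_only x hx (fun h => hxK ⟨hx, Or.inl h⟩) hxX)⟩
      have hvx : G.Adj v x := by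
        by_contra hn
        exact hxS ⟨hx, Or.inr ⟨hxX, hn⟩⟩
      refine (hleg t ht htX y hy hyX hvt hty hvy x hx hxX
        (by rintro rfl; exact hvt hvx) ?_).2.1 hvx
      rintro rfl
      exact hxK ⟨hx, Or.inr ⟨hxX, hvy, t, ht, htX, hvt, hty⟩⟩
  · rintro x hx hxS hxK y ⟨hy, rfl | ⟨hyX, hvy⟩⟩ hxy
    · refine hzx x hx ?_ hxy
      by_contra hxX
      exact hxS ⟨hx, Or.inl (hz_only x hx (fun h => hxK ⟨hx, Or.inl h⟩) hxX)⟩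
    · have hxX : x ∈ X := by
        by_contra hxX
        exact hxS ⟨hx, Or.inl (hz_only x hx (fun h => hxK ⟨hx, Or.inl h⟩) hxX)⟩
      have hvx : G.Adj v x := by
        by_contra hn
        exact hxS ⟨hx, Or.inr ⟨hxX, hn⟩⟩
      exact hxK ⟨hx, Or.inr ⟨hxX, hvx, y, hy, hyX, hvy, hxy.symm⟩⟩

/-- Two legs and their body vertices form a `P₄`, so `v` sees all of `S ∪ K`, none of it, or exactly
`K`. In the last case `v` joins the head; the other two are excluded because deleting some head
vertex would create a cut or a co-cut. -/
theorem isThinSpider_of_delete (hG : Sparse G) {W S K : Set V} {v : V} (hv : v ∈ W)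
    (h : IsThinSpider G (W \ {v}) S K) (h1 : ¬ Cut G W) (h2 : ¬ Cut Gᶜ W)
    (h3 : ∀ r ∈ W, ¬ Cut G (W \ {r})) (h4 : ∀ r ∈ W, ¬ Cut Gᶜ (W \ {r})) :
    IsThinSpider G W S K := by
  obtain ⟨s₁, hs₁, s₂, hs₂, hs⟩ := h.nontrivial
  obtain ⟨k₁, hk₁, hsk₁⟩ := h.exists_body s₁ hs₁
  have hSW : ∀ x ∈ S, x ∈ W ∧ x ≠ v := fun x hx => h.legs_subset hx
  have hKW : ∀ x ∈ K, x ∈ W ∧ x ≠ v := fun x hx => h.body_subset hx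
  have hP : ∀ s s' k k', s ∈ S → s' ∈ S → k ∈ K → k' ∈ K → s ≠ s' → G.Adj s k → G.Adj s' k' →
      IsP4 G s k k' s' := by
    intro s s' k k' hs hs' hk hk' hne hsk hsk'
    have hn : k ≠ k' := by rintro rfl; exact hne (h.leg_unique k hk s hs s' hs' hsk hsk')
    refine ⟨hsk, h.clique k hk k' hk' hn, hsk'.symm, ?_, ?_, h.indep s hs s' hs'⟩
    · exact fun hk2 => hn (h.body_unique s hs k hk k' hk' hsk hk2)
    · exact fun hk2 => hn (h.body_unique s' hs' k hk k' hk' hk2.symm hsk')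
  have hty : ∀ s s' k k', s ∈ S → s' ∈ S → k ∈ K → k' ∈ K → s ≠ s' → G.Adj s k → G.Adj s' k' →
      (G.Adj v s ↔ G.Adj v s') ∧ (G.Adj v k ↔ G.Adj v k') ∧ (G.Adj v s → G.Adj v k) := by
    intro s s' k k' hs hs' hk hk' hne hsk hsk'
    have := hG s k k' s' v (hP s s' k k' hs hs' hk hk' hne hsk hsk') (hSW s hs).2.symm
      (hKW k hk).2.symm (hKW k' hk').2.symm (hSW s' hs').2.symm
    tauto
  have hS : ∀ x ∈ S, (G.Adj v s₁ ↔ G.Adj v x) := by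
    intro x hx
    by_cases hne : s₁ = x
    · rw [hne]
    · obtain ⟨k, hk, hxk⟩ := h.exists_body x hx
      exact (hty s₁ x k₁ k hs₁ hx hk₁ hk hne hsk₁ hxk).1
  have hK : ∀ x ∈ K, (G.Adj v k₁ ↔ G.Adj v x) := by
    intro x hx
    obtain ⟨t, ht, htx⟩ := h.exists_leg x hx
    by_cases hne : s₁ = t
    · subst hne
      rw [h.body_unique s₁ ht k₁ hk₁ x hx hsk₁ htx]
    · exact (hty s₁ t k₁ x hs₁ ht hk₁ hx hne hsk₁ htx).2.1
  have hSK : G.Adj v s₁ → G.Adj v k₁ := by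
    obtain ⟨k₂, hk₂, hsk₂⟩ := h.exists_body s₂ hs₂
    exact (hty s₁ s₂ k₁ k₂ hs₁ hs₂ hk₁ hk₂ hs hsk₁ hsk₂).2.2
  have hhead : ∀ x ∈ W, x ≠ v → x ∉ S → x ∉ K → G.Adj x k₁ ∧ ∀ t ∈ S, ¬ G.Adj x t :=
    fun x hx hxv hxS hxK => ⟨h.head_body x ⟨hx, hxv⟩ hxS hxK k₁ hk₁,
      h.head_legs x ⟨hx, hxv⟩ hxS hxK⟩
  by_cases hvs : G.Adj v s₁
  · exfalso
    have hvk := hSK hvs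
    obtain ⟨r, hr, hrv, hvr⟩ : ∃ r ∈ W, r ≠ v ∧ ¬ G.Adj v r := by
      by_contra! hn
      refine h2 ⟨{v}, ⟨v, hv, rfl⟩, ⟨s₁, hSW s₁ hs₁⟩, ?_⟩
      rintro x hx rfl y hy hyx hxy
      exact (compl_adj _ _ _).1 hxy |>.2 (hn y hy hyx)
    have hrS : r ∉ S := fun hrS => hvr ((hS r hrS).1 hvs)
    have hrK : r ∉ K := fun hrK => hvr ((hK r hrK).1 hvk)
    -- The vertex `r` is the only non-neighbour of `v`: any other head vertex sees `k₁` but not `s₂`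
    -- on the path `r k₁ v s₂`, hence sees `v`. So `v` is universal once `r` is deleted.
    refine h4 r hr ⟨{v}, ⟨v, ⟨hv, hrv.symm⟩, rfl⟩, ⟨s₁, ⟨(hSW s₁ hs₁).1, ?_⟩, (hSW s₁ hs₁).2⟩, ?_⟩
    · rintro rfl
      exact hrS hs₁
    rintro x - rfl y ⟨hy, hyr⟩ hyx hxy
    refine ((compl_adj _ _ _).1 hxy).2 ?_
    by_cases hyS : y ∈ S
    · exact (hS y hyS).1 hvs
    by_cases hyK : y ∈ K
    · exact (hK y hyK).1 hvk
    have hk₁s₂ : ¬ G.Adj k₁ s₂ := fun hn => hs (h.leg_unique k₁ hk₁ s₁ hs₁ s₂ hs₂ hsk₁ hn.symm)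
    have hrk := hhead r hr hrv hrS hrK
    have hyk := hhead y hy hyx hyS hyK
    have := hG r k₁ x s₂ y ⟨hrk.1, hvk.symm, (hS s₂ hs₂).1 hvs, fun hn => hvr hn.symm, hk₁s₂,
      hrk.2 s₂ hs₂⟩ hyr (by rintro rfl; exact hyK hk₁) hyx (by rintro rfl; exact hyS hs₂)
    have e1 := hyk.1
    have e2 := hyk.2 s₂ hs₂
    rw [G.adj_comm x y]
    tauto
  have hvS : ∀ x ∈ S, ¬ G.Adj v x := fun x hx hvx => hvs ((hS x hx).2 hvx)
  by_cases hvk : G.Adj v k₁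
  · have hvS' : v ∉ S := fun hvS => (hSW v hvS).2 rfl
    refine ⟨fun x hx => (hSW x hx).1, fun x hx => (hKW x hx).1, h.disjoint, h.nontrivial, h.indep,
      h.clique, h.exists_body, h.exists_leg, h.body_unique, h.leg_unique, ?_, ?_⟩
    · intro x hx hxS hxK
      by_cases hxv : x = v
      · subst hxv
        exact fun y hy => (hK y hy).1 hvk
      · exact h.head_body x ⟨hx, hxv⟩ hxS hxK
    · intro x hx hxS hxK
      by_cases hxv : x = v
      · subst hxv
        exact hvS
      · exact h.head_legs x ⟨hx, hxv⟩ hxS hxK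
  · exfalso
    obtain ⟨r, hr, hrv, hvr⟩ : ∃ r ∈ W, r ≠ v ∧ G.Adj v r := by
      by_contra! hn
      refine h1 ⟨{v}, ⟨v, hv, rfl⟩, ⟨s₁, hSW s₁ hs₁⟩, ?_⟩
      rintro x hx rfl y hy hyx hxy
      exact hn y hy hyx hxy
    have hrS : r ∉ S := fun hrS => hvS r hrS hvr
    have hrK : r ∉ K := fun hrK => hvk ((hK r hrK).2 hvr)
    -- Dually, the path `s₁ k₁ r v` shows that `r` is the only neighbour of `v`.
    refine h3 r hr ⟨{v}, ⟨v, ⟨hv, hrv.symm⟩, rfl⟩, ⟨s₁, ⟨(hSW s₁ hs₁).1, ?_⟩, (hSW s₁ hs₁).2⟩, ?_⟩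
    · rintro rfl
      exact hrS hs₁
    rintro x - rfl y ⟨hy, hyr⟩ hyx hxy
    by_cases hyS : y ∈ S
    · exact hvS y hyS hxy
    by_cases hyK : y ∈ K
    · exact hvk ((hK y hyK).2 hxy)
    have hrk := hhead r hr hrv hrS hrK
    have hyk := hhead y hy hyx hyS hyK
    have := hG s₁ k₁ r x y ⟨hsk₁, hrk.1.symm, hvr.symm, fun hn => hrk.2 s₁ hs₁ hn.symm,
      fun hn => hvk hn.symm, fun hn => hvs hn.symm⟩ (by rintro rfl; exact hyS hs₁)
      (by rintro rfl; exact hyK hk₁) hyr hyx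
    have e1 := hyk.1
    have e2 := hyk.2 s₁ hs₁
    rw [G.adj_comm x y] at hxy
    tauto

/-- Since `W` has no co-cut, `v` has a non-neighbour; whichever side contains it plays the role of
`X`. -/
theorem exists_thinSpider_of_cut_delete (hG : Sparse G) {W : Set V} {v : V} (hv : v ∈ W)
    (h : Cut G (W \ {v})) (h1 : ¬ Cut G W) (h2 : ¬ Cut Gᶜ W) :
    ∃ S K, IsThinSpider G W S K := by
  obtain ⟨X, ⟨x, ⟨hx, hxv⟩, hxX⟩, ⟨y, ⟨hy, hyv⟩, hyX⟩, hXY⟩ := h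
  obtain ⟨z, hz, hzv, hvz⟩ : ∃ z ∈ W, z ≠ v ∧ ¬ G.Adj v z := by
    by_contra! hn
    refine h2 ⟨{v}, ⟨v, hv, rfl⟩, ⟨x, hx, hxv⟩, ?_⟩
    rintro a ha rfl b hb hba hab
    exact (compl_adj _ _ _).1 hab |>.2 (hn b hb hba)
  by_cases hzX : z ∈ X
  · refine exists_thinSpider_of_cut hG (X := X \ {v}) hv (fun h => h.2 rfl)
      ⟨z, hz, ⟨hzX, hzv⟩, hvz⟩ ⟨y, hy, hyv, fun h => hyX h.1⟩ ?_ h1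
    rintro a ha ⟨haX, hav⟩ b hb hbv hbX
    exact hXY a ⟨ha, hav⟩ haX b ⟨hb, hbv⟩ fun h => hbX ⟨h, hbv⟩
  · refine exists_thinSpider_of_cut hG (X := Xᶜ \ {v}) hv (fun h => h.2 rfl)
      ⟨z, hz, ⟨hzX, hzv⟩, hvz⟩ ⟨x, hx, hxv, fun h => h.1 hxX⟩ ?_ h1
    rintro a ha ⟨haX, hav⟩ b hb hbv hbX hab
    refine hXY b ⟨hb, hbv⟩ ?_ a ⟨ha, hav⟩ haX hab.symm
    by_contra hn
    exact hbX ⟨hn, hbv⟩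

/-- Structure theorem for `P₄`-sparse graphs. -/
theorem Sparse.cut_or_spider [Finite V] (hG : Sparse G) (W : Set V) (hW : W.Nontrivial) :
    Cut G W ∨ Cut Gᶜ W ∨ (∃ S K, IsThinSpider G W S K) ∨ ∃ S K, IsThinSpider Gᶜ W S K := by
  induction hn : W.ncard using Nat.strong_induction_on generalizing W with
  | _ n ih =>
    subst hn
    by_contra hcon
    push Not at hcon
    obtain ⟨h1, h2, h3, h4⟩ := hcon
    -- In a counterexample no deletion creates a cut or a co-cut. By induction `W \ {v}` is then a
    -- spider or a co-spider, which extends to `W`.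
    have hd : ∀ r ∈ W, ¬ Cut G (W \ {r}) := fun r hr hc => by
      obtain ⟨S, K, h⟩ := exists_thinSpider_of_cut_delete hG hr hc h1 h2
      exact h3 S K h
    have hd' : ∀ r ∈ W, ¬ Cut Gᶜ (W \ {r}) := fun r hr hc => by
      obtain ⟨S, K, h⟩ := exists_thinSpider_of_cut_delete hG.compl hr hc h2 (by simpa using h1)
      exact h4 S K h
    obtain ⟨v, hv⟩ := hW.nonempty
    by_cases hv' : (W \ {v}).Nontrivial
    · rcases ih _ (Set.ncard_lt_ncard (Set.sdiff_singleton_ssubset.2 hv)) _ hv' rfl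
        with h | h | ⟨S, K, h⟩ | ⟨S, K, h⟩
      · exact hd v hv h
      · exact hd' v hv h
      · exact h3 S K (isThinSpider_of_delete hG hv h h1 h2 hd hd')
      · exact h4 S K (isThinSpider_of_delete hG.compl hv h h2 (by simpa using h1) hd'
          (by simpa using hd))
    · rw [Set.not_nontrivial_iff] at hv'
      obtain ⟨u, hu, huv⟩ := hW.exists_ne v
      have huniq : ∀ y ∈ W, y ≠ v → y = u := fun y hy hyv => hv' ⟨hy, hyv⟩ ⟨hu, huv⟩
      by_cases hvu : G.Adj v u
      · refine h2 ⟨{v}, ⟨v, hv, rfl⟩, ⟨u, hu, huv⟩, ?_⟩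
        rintro a ha rfl b hb hba hab
        rw [huniq b hb hba] at hab
        exact ((compl_adj _ _ _).1 hab).2 hvu
      · refine h1 ⟨{v}, ⟨v, hv, rfl⟩, ⟨u, hu, huv⟩, ?_⟩
        rintro a ha rfl b hb hba hab
        rw [huniq b hb hba] at hab
        exact hvu hab

/-! ### Connectedness, and why spiders are not minimal obstructions -/

theorem cut_univ_iff : Cut G Set.univ ↔ ¬ G.Preconnected := by
  constructor
  · rintro ⟨X, ⟨x, -, hx⟩, ⟨y, -, hy⟩, hXY⟩ hG
    obtain ⟨p⟩ := hG x y
    obtain ⟨d, -, hd, hd'⟩ := p.exists_boundary_dart X hx hy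
    exact hXY _ trivial hd _ trivial hd' d.adj
  · intro h
    simp only [Preconnected, not_forall] at h
    obtain ⟨x, y, hxy⟩ := h
    exact ⟨{z | G.Reachable x z}, ⟨x, trivial, Reachable.refl x⟩, ⟨y, trivial, hxy⟩,
      fun a _ ha b _ hb hab => hb (Reachable.trans ha hab.reachable)⟩

/-- A graph with a spider partition is never a minimal `(s, 1)`-polar obstruction. -/
theorem not_isMinimalPolarObstruction_of_spider (S K : Set V) (hSK : ∀ x ∈ S, x ∉ K)
    (hS2 : ∃ x ∈ S, ∃ y ∈ S, x ≠ y) (hKn : ∃ k, k ∈ K) (hS : ∀ x ∈ S, ∀ y ∈ S, ¬ G.Adj x y)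
    (hK : ∀ x ∈ K, ∀ y ∈ K, x ≠ y → G.Adj x y)
    (hRK : ∀ x, x ∉ S → x ∉ K → ∀ y ∈ K, G.Adj x y)
    (hRS : ∀ x, x ∉ S → x ∉ K → ∀ y ∈ S, ¬ G.Adj x y) : ¬ IsMinimalPolarObstruction s 1 G := by
  intro h
  obtain ⟨x, hx, y, hy, hxy⟩ := hS2
  obtain ⟨k, hk⟩ := hKn
  obtain ⟨A, f, h1, h2, h3⟩ := h.polarOn_of_notMem (W := Kᶜ) (v := k) (fun h => h hk)
  -- The clique part contains at most one of the independent legs.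
  obtain ⟨z, hz, hzA⟩ : ∃ z ∈ S, z ∈ A := by
    by_contra! hn
    exact hS x hx y hy (h3 x (hSK x hx) (hn x hx) y (hSK y hy) (hn y hy) hxy)
  have hs : 1 ≤ s := (Nat.zero_le _).trans_lt (h1 z (hSK z hz) hzA)
  have hzR : ∀ r ∉ K, ¬ G.Adj r z := by
    intro r hr
    by_cases hrS : r ∈ S
    · exact hS r hrS z hz
    · exact hRS r hrS hr z hz
  -- Outside `K` the leg `z` is isolated, so everything in `A` shares its colour and `A \ K` is
  -- independent.
  have hA : ∀ a ∉ K, a ∈ A → ∀ b ∉ K, b ∈ A → ¬ G.Adj a b := by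
    intro a ha haA b hb hbA hab
    have e1 := h2 a ha haA b hb hbA
    have e2 := h2 a ha haA z (hSK z hz) hzA
    have e3 := h2 b hb hbA z (hSK z hz) hzA
    have e4 := hzR a ha
    have e5 := hzR b hb
    simp_all
  refine (isMinimalPolarObstruction_iff.1 h).1 (PolarOn.mono_right ?_ hs)
  -- A split partition: the legs and the rest of `A` are independent, while the body and the head
  -- vertices outside `A` form a clique.
  refine PolarOn.of_colouring (S ∪ (A \ K)) {0} (fun _ => 0) (by simp) (by simp) ?_ ?_
  · rintro a - ha b - hb
    simp only [ne_eq, not_true, iff_false]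
    rcases ha with ha | ⟨haA, haK⟩
    · rcases hb with hb | ⟨hbA, hbK⟩
      · exact hS a ha b hb
      · by_cases hbS : b ∈ S
        · exact hS a ha b hbS
        · exact fun hab => hRS b hbS hbK a ha hab.symm
    · rcases hb with hb | ⟨hbA, hbK⟩
      · by_cases haS : a ∈ S
        · exact hS a haS b hb
        · exact hRS a haS haK b hb
      · exact hA a haK haA b hbK hbA
  · rintro a - ha b - hb hab
    simp only [Set.mem_union, Set.mem_sdiff, not_or, not_and, not_not] at ha hb
    by_cases haK : a ∈ K
    · by_cases hbK : b ∈ K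
      · exact hK a haK b hbK hab
      · exact (hRK b hb.1 hbK a haK).symm
    · by_cases hbK : b ∈ K
      · exact hRK a ha.1 haK b hbK
      · exact h3 a haK (fun h => haK (ha.2 h)) b hbK (fun h => hbK (hb.2 h)) hab

theorem IsMinimalPolarObstruction.nontrivial (h : IsMinimalPolarObstruction s 1 G) :
    (Set.univ : Set V).Nontrivial := by
  by_contra hn
  rw [Set.not_nontrivial_iff] at hn
  refine (isMinimalPolarObstruction_iff.1 h).1 ⟨∅, fun _ => 0, by simp, by simp, ?_⟩
  intro x _ _ y _ _ hxy
  exact absurd (hn trivial trivial) hxy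

theorem IsThinSpider.not_isMinimalPolarObstruction {S K : Set V}
    (h : IsThinSpider G Set.univ S K) : ¬ IsMinimalPolarObstruction s 1 G := by
  obtain ⟨x, hx, -⟩ := h.nontrivial
  obtain ⟨k, hk, -⟩ := h.exists_body x hx
  exact not_isMinimalPolarObstruction_of_spider S K h.disjoint h.nontrivial ⟨k, hk⟩ h.indep
    h.clique (fun x => h.head_body x trivial) (fun x => h.head_legs x trivial)

/-- Complementation exchanges legs and body. The spider argument never uses the edges between them,
so it covers thick spiders too. -/
theorem IsThinSpider.not_isMinimalPolarObstruction_of_compl {S K : Set V}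
    (h : IsThinSpider Gᶜ Set.univ S K) : ¬ IsMinimalPolarObstruction s 1 G := by
  have hd : ∀ x ∈ K, x ∉ S := fun x hx hx' => h.disjoint x hx' hx
  have hne : ∀ x ∉ K, ∀ y ∈ K, x ≠ y := by rintro x hx y hy rfl; exact hx hy
  have hne' : ∀ x ∉ S, ∀ y ∈ S, x ≠ y := by rintro x hx y hy rfl; exact hx hy
  obtain ⟨x, hx, y, hy, hxy⟩ := h.nontrivial
  obtain ⟨k, hk, hxk⟩ := h.exists_body x hx
  obtain ⟨l, hl, hyl⟩ := h.exists_body y hy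
  have hkl : k ≠ l := by rintro rfl; exact hxy (h.leg_unique k hk x hx y hy hxk hyl)
  refine not_isMinimalPolarObstruction_of_spider K S hd ⟨k, hk, l, hl, hkl⟩ ⟨x, hx⟩ ?_ ?_ ?_ ?_
  · intro a ha b hb hab
    exact ((compl_adj _ _ _).1 (h.clique a ha b hb hab.ne)).2 hab
  · intro a ha b hb hab
    by_contra hn
    exact h.indep a ha b hb ((compl_adj _ _ _).2 ⟨hab, hn⟩)
  · intro a ha hb b hbS
    by_contra hn
    exact h.head_legs a trivial hb ha b hbS ((compl_adj _ _ _).2 ⟨hne' a hb b hbS, hn⟩)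
  · intro a ha hb b hbK hab
    exact ((compl_adj _ _ _).1 (h.head_body a trivial hb ha b hbK)).2 hab

theorem IsMinimalPolarObstruction.not_preconnected_or [Finite V] (hG : Sparse G)
    (h : IsMinimalPolarObstruction s 1 G) : ¬ G.Preconnected ∨ ¬ Gᶜ.Preconnected := by
  rcases hG.cut_or_spider Set.univ h.nontrivial with h' | h' | ⟨S, K, h'⟩ | ⟨S, K, h'⟩
  · exact Or.inl (cut_univ_iff.1 h')
  · exact Or.inr (cut_univ_iff.1 h')
  · exact absurd h h'.not_isMinimalPolarObstruction
  · exact absurd h h'.not_isMinimalPolarObstruction_of_compl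

/-! ### Complete multipartite vertex sets -/

/-- `X` induces a complete multipartite graph: non-adjacency is transitive on `X`. -/
def Multipartite (G : SimpleGraph V) (X : Set V) : Prop :=
  ∀ x ∈ X, ∀ y ∈ X, ∀ z ∈ X, ¬ G.Adj x y → ¬ G.Adj y z → ¬ G.Adj x z

/-- A clique of size `s + 1` inside a complete multipartite set is the only thing that prevents
the set from having at most `s` parts. -/
theorem polarOn_univ_of_multipartite [Finite V] {A : Set V} (hA : Multipartite G A)
    (hQ : ∀ Q : Finset V, (∀ x ∈ Q, x ∈ A) → (∀ x ∈ Q, ∀ y ∈ Q, x ≠ y → G.Adj x y) → Q.card ≤ s)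
    (hB : ∀ x, x ∉ A → ∀ y, y ∉ A → x ≠ y → G.Adj x y) : PolarOn G s Set.univ := by
  classical
  have := Fintype.ofFinite V
  -- A maximum clique `Q` of `A` meets every part, so a vertex can be coloured by an element of `Q`
  -- not adjacent to it.
  obtain ⟨Q, hQm, hmax⟩ := Finset.exists_max_image
    (Finset.univ.filter fun Q : Finset V => (∀ x ∈ Q, x ∈ A) ∧ ∀ x ∈ Q, ∀ y ∈ Q, x ≠ y → G.Adj x y)
    Finset.card ⟨∅, by simp⟩
  simp only [Finset.mem_filter, Finset.mem_univ, true_and] at hQm hmax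
  have hrep : ∀ x, ∃ q, x ∈ A → q ∈ Q ∧ ¬ G.Adj x q := by
    intro x
    by_contra! hn
    obtain ⟨hxA, hn⟩ := forall_and.1 hn
    have hxA := hxA x
    have hxQ : x ∉ Q := fun hx => G.loopless.irrefl _ (hn x hx)
    have := hmax (insert x Q) ⟨?_, ?_⟩
    · rw [Finset.card_insert_of_notMem hxQ] at this
      omega
    · intro y hy
      rcases Finset.mem_insert.1 hy with rfl | hy
      · exact hxA
      · exact hQm.1 y hy
    · intro y hy z hz hyz
      rw [Finset.mem_insert] at hy hz
      rcases hy with rfl | hy <;> rcases hz with rfl | hz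
      · exact absurd rfl hyz
      · exact hn z hz
      · exact (hn y hy).symm
      · exact hQm.2 y hy z hz hyz
  choose f hf using hrep
  refine PolarOn.of_colouring A Q f (hQ Q hQm.1 hQm.2) (fun x _ hx => (hf x hx).1) ?_
    fun x _ hx y _ hy => hB x hx y hy
  intro x _ hx y _ hy
  obtain ⟨hfx, hxf⟩ := hf x hx
  obtain ⟨hfy, hyf⟩ := hf y hy
  constructor
  · intro hxy he
    rw [← he] at hyf
    exact hA x hx (f x) (hQm.1 _ hfx) y hy hxf (fun h => hyf h.symm) hxy
  · intro hne
    by_contra hxy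
    refine hA (f x) (hQm.1 _ hfx) x hx (f y) (hQm.1 _ hfy) (fun h => hxf h.symm) ?_
      (hQm.2 _ hfx _ hfy hne)
    exact hA x hx y hy (f y) (hQm.1 _ hfy) hxy hyf

/-! ### Split graphs -/

/-- The Földes–Hammer characterisation of split graphs, with `C₅` ruled out by sparsity. Among the
maximum cliques one takes `Q` with greatest degree sum, and shows that an edge `x y` outside `Q`
leads to a contradiction. -/
theorem exists_2K2_or_C4 [Finite V] (hG : Sparse G)
    (hsplit : ¬ ∃ K : Set V, (∀ x ∈ K, ∀ y ∈ K, x ≠ y → G.Adj x y) ∧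
      ∀ x, x ∉ K → ∀ y, y ∉ K → ¬ G.Adj x y) :
    (∃ a b c d, G.Adj a b ∧ G.Adj c d ∧ ¬ G.Adj a c ∧ ¬ G.Adj a d ∧ ¬ G.Adj b c ∧ ¬ G.Adj b d) ∨
    ∃ a b c d, G.Adj a b ∧ G.Adj b c ∧ G.Adj c d ∧ G.Adj d a ∧ ¬ G.Adj a c ∧ ¬ G.Adj b d ∧
      a ≠ c ∧ b ≠ d := by
  classical
  have := Fintype.ofFinite V
  by_contra! hcon
  obtain ⟨hK2, hC4⟩ := hcon
  let P : Finset V → Prop := fun Q => ∀ x ∈ Q, ∀ y ∈ Q, x ≠ y → G.Adj x y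
  have hPins : ∀ Q x, P Q → (∀ y ∈ Q, G.Adj x y) → P (insert x Q) := by
    intro Q x hQ hx y hy z hz hyz
    rw [Finset.mem_insert] at hy hz
    rcases hy with rfl | hy <;> rcases hz with rfl | hz
    · exact absurd rfl hyz
    · exact hx z hz
    · exact (hx y hy).symm
    · exact hQ y hy z hz hyz
  obtain ⟨Q₀, hQ₀, hmax₀⟩ := Finset.exists_max_image (Finset.univ.filter P) Finset.card
    ⟨∅, by simp [P]⟩
  obtain ⟨Q, hQ, hmax⟩ := Finset.exists_max_image
    (Finset.univ.filter fun Q => P Q ∧ Q.card = Q₀.card) (fun Q => ∑ x ∈ Q, G.degree x)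
    ⟨Q₀, by simpa using hQ₀⟩
  simp only [Finset.mem_filter, Finset.mem_univ, true_and] at hQ₀ hmax₀ hQ hmax
  obtain ⟨hQ, hQc⟩ := hQ
  have hcard : ∀ R, P R → R.card ≤ Q.card := fun R hR => hQc ▸ hmax₀ R hR
  obtain ⟨x, hx, y, hy, hxy⟩ : ∃ x, x ∉ Q ∧ ∃ y, y ∉ Q ∧ G.Adj x y := by
    by_contra! hn
    exact hsplit ⟨Q, hQ, fun x hx y hy => hn x hx y hy⟩
  have hnon : ∀ x, x ∉ Q → ∃ u ∈ Q, ¬ G.Adj x u := by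
    intro x hx
    by_contra! hn
    have := hcard _ (hPins Q x hQ hn)
    rw [Finset.card_insert_of_notMem hx] at this
    omega
  have hne : ∀ x, x ∉ Q → ∀ y ∈ Q, x ≠ y := by rintro x hx y hy rfl; exact hx hy
  -- Without `C₄`, the non-neighbourhoods of `x` and `y` in `Q` are nested; without `2K₂`, they
  -- share at most one vertex. So one endpoint, renamed `x`, misses exactly one vertex `u` of `Q`.
  have hcross : ∀ u ∈ Q, ∀ v ∈ Q, ¬ G.Adj x u → ¬ G.Adj y v → G.Adj y u → G.Adj x v → False := by
    intro u hu v hv hxu hyv hyu hxv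
    have huv : u ≠ v := by rintro rfl; exact hxu hxv
    exact hne y hy v hv (hC4 x y u v hxy hyu (hQ u hu v hv huv) hxv.symm hxu hyv (hne x hx u hu))
  obtain ⟨u, hu, hxu, hyu⟩ : ∃ u ∈ Q, ¬ G.Adj x u ∧ ¬ G.Adj y u := by
    by_contra! hn
    obtain ⟨u, hu, hxu⟩ := hnon x hx
    obtain ⟨v, hv, hyv⟩ := hnon y hy
    exact hcross u hu v hv hxu hyv (hn u hu hxu) (by by_contra h; exact hyv (hn v hv h))
  have huniq : ∀ w ∈ Q, ¬ G.Adj x w → ¬ G.Adj y w → w = u := by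
    intro w hw hxw hyw
    by_contra hwu
    exact hyw (hK2 x y u w hxy (hQ u hu w hw (Ne.symm hwu)) hxu hxw hyu)
  obtain ⟨x, y, hx, hy, hxy, hxu, hyu, hxall⟩ : ∃ x y, x ∉ Q ∧ y ∉ Q ∧ G.Adj x y ∧
      ¬ G.Adj x u ∧ ¬ G.Adj y u ∧ ∀ w ∈ Q, w ≠ u → G.Adj x w := by
    by_cases hxall : ∀ w ∈ Q, w ≠ u → G.Adj x w
    · exact ⟨x, y, hx, hy, hxy, hxu, hyu, hxall⟩
    · refine ⟨y, x, hy, hx, hxy.symm, hyu, hxu, ?_⟩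
      by_contra! hn
      push Not at hxall
      obtain ⟨w, hw, hwu, hyw⟩ := hn
      obtain ⟨t, ht, htu, hxt⟩ := hxall
      refine hcross t ht w hw hxt hyw ?_ ?_
      · by_contra hyt; exact htu (huniq t ht hxt hyt)
      · by_contra hxw; exact hwu (huniq w hw hxw hyw)
  have hPQ' : P (insert x (Q.erase u)) := by
    refine hPins _ _ (fun a ha b hb => hQ a (Finset.mem_of_mem_erase ha) b
      (Finset.mem_of_mem_erase hb)) fun a ha => ?_
    exact hxall a (Finset.mem_of_mem_erase ha) (Finset.ne_of_mem_erase ha)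
  have hxe : x ∉ Q.erase u := fun h => hx (Finset.mem_of_mem_erase h)
  have hcard' : (insert x (Q.erase u)).card = Q.card := by
    rw [Finset.card_insert_of_notMem hxe, Finset.card_erase_add_one hu]
  obtain ⟨v, hv, hvu, hyv⟩ : ∃ v ∈ Q, v ≠ u ∧ ¬ G.Adj y v := by
    by_contra! hn
    have := hcard _ (hPins _ y hPQ' ?_)
    · rw [Finset.card_insert_of_notMem, hcard'] at this
      · omega
      · simp [hxy.ne', hy]
    · intro a ha
      rcases Finset.mem_insert.1 ha with rfl | ha
      · exact hxy.symm
      · exact hn a (Finset.mem_of_mem_erase ha) (Finset.ne_of_mem_erase ha)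
  have hxv := hxall v hv hvu
  have hdeg : G.degree x ≤ G.degree u := by
    have := hmax _ ⟨hPQ', hcard'.trans hQc⟩
    rw [Finset.sum_insert hxe, ← Finset.add_sum_erase Q _ hu] at this
    omega
  -- As `y` sees `x` but not `u`, the inequality `deg x ≤ deg u` yields a neighbour `z` of `u`
  -- missed by `x`. Then `u z y x` is a `P₄`, and `v` sees both ends but not `y`.
  obtain ⟨z, huz, hxz⟩ : ∃ z, G.Adj u z ∧ ¬ G.Adj x z := by
    by_contra! hn
    have hss : G.neighborFinset u ⊂ G.neighborFinset x := by
      refine (Finset.ssubset_iff_of_subset fun z hz => ?_).2 ⟨y, by simpa using hxy, ?_⟩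
      · simpa using hn z (by simpa using hz)
      · simpa using fun h => hyu (G.adj_symm h)
    have := Finset.card_lt_card hss
    rw [G.card_neighborFinset_eq_degree, G.card_neighborFinset_eq_degree] at this
    omega
  have hzy : G.Adj z y := by
    by_contra hzy
    exact hzy (hK2 u z x y huz hxy (fun h => hxu h.symm) (fun h => hyu h.symm)
      fun h => hxz h.symm)
  have hvz : v ≠ z := by rintro rfl; exact hxz hxv
  have := hG u z y x v ⟨huz, hzy, hxy.symm, fun h => hyu h.symm, fun h => hxz h.symm,
    fun h => hxu h.symm⟩ hvu hvz (hne y hy v hv).symm (hne x hx v hv).symm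
  have e1 := hQ v hv u hu hvu
  have e2 : ¬ G.Adj v y := fun h => hyv h.symm
  tauto

/-! ### Embeddings of small graphs -/

/-- `H` is isomorphic to an induced subgraph of `G` inside `X`. -/
def EmbedsIn (H : SimpleGraph V') (G : SimpleGraph V) (X : Set V) : Prop :=
  ∃ φ : H ↪g G, ∀ x, φ x ∈ X

theorem EmbedsIn.nonempty {X : Set V} (h : EmbedsIn H G X) : Nonempty (H ↪g G) :=
  ⟨h.choose⟩

theorem EmbedsIn.of_fun {X : Set V} (f : V' → V) (hf : Function.Injective f)
    (h : ∀ x y, G.Adj (f x) (f y) ↔ H.Adj x y) (hX : ∀ x, f x ∈ X) : EmbedsIn H G X :=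
  ⟨⟨⟨f, hf⟩, h _ _⟩, hX⟩

section

variable {W₁ : Type*} {W₂ : Type*} {H₁ : SimpleGraph W₁} {H₂ : SimpleGraph W₂} {X Y : Set V}

theorem EmbedsIn.sum (h₁ : EmbedsIn H₁ G X) (h₂ : EmbedsIn H₂ G Y)
    (h : ∀ x ∈ X, ∀ y ∈ Y, x ≠ y ∧ ¬ G.Adj x y) : EmbedsIn (H₁ ⊕g H₂) G (X ∪ Y) := by
  obtain ⟨φ, hφ⟩ := h₁
  obtain ⟨ψ, hψ⟩ := h₂
  have hne : ∀ x y, φ x ≠ ψ y := fun x y => (h _ (hφ x) _ (hψ y)).1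
  have hadj : ∀ x y, ¬ G.Adj (φ x) (ψ y) := fun x y => (h _ (hφ x) _ (hψ y)).2
  have hadj' : ∀ x y, ¬ G.Adj (ψ y) (φ x) := fun x y h => hadj x y h.symm
  refine EmbedsIn.of_fun (Sum.elim φ ψ) (φ.injective.sumElim ψ.injective hne) ?_ ?_
  · rintro (x | x) (y | y) <;> simp [hadj, hadj']
  · rintro (x | x)
    · exact Or.inl (hφ x)
    · exact Or.inr (hψ x)

theorem EmbedsIn.join (h₁ : EmbedsIn H₁ G X) (h₂ : EmbedsIn H₂ G Y)
    (h : ∀ x ∈ X, ∀ y ∈ Y, G.Adj x y) : EmbedsIn (join H₁ H₂) G (X ∪ Y) := by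
  obtain ⟨φ, hφ⟩ := h₁
  obtain ⟨ψ, hψ⟩ := h₂
  have hadj : ∀ x y, G.Adj (φ x) (ψ y) := fun x y => h _ (hφ x) _ (hψ y)
  have hadj' : ∀ x y, G.Adj (ψ y) (φ x) := fun x y => (hadj x y).symm
  refine EmbedsIn.of_fun (Sum.elim φ ψ)
    (φ.injective.sumElim ψ.injective fun x y => (hadj x y).ne) ?_ ?_
  · rintro (x | x) (y | y) <;> simp [PolarObs.join, hadj, hadj']
  · rintro (x | x)
    · exact Or.inl (hφ x)
    · exact Or.inr (hψ x)

end

theorem EmbedsIn.of_compl {X : Set V} (h : EmbedsIn H Gᶜ X) : EmbedsIn Hᶜ G X := by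
  obtain ⟨φ, hφ⟩ := h
  refine EmbedsIn.of_fun φ φ.injective (fun x y => ?_) hφ
  have h1 := φ.map_adj_iff (v := x) (w := y)
  have h2 := φ.injective.eq_iff (a := x) (b := y)
  simp only [compl_adj] at h1 ⊢
  by_cases hxy : x = y
  · simp [hxy]
  · simp only [hxy, iff_false] at h2
    simp only [ne_eq, h2, not_false_eq_true, true_and, hxy] at h1 ⊢
    rw [← h1, not_not]

theorem embedsIn_K {n : ℕ} (Q : Finset V) (hQ : ∀ x ∈ Q, ∀ y ∈ Q, x ≠ y → G.Adj x y)
    (hn : n ≤ Q.card) : EmbedsIn (K n) G Q := by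
  let e : Fin n → V := fun i => Q.equivFin.symm (Fin.castLE hn i)
  have he : Function.Injective e :=
    Subtype.val_injective.comp (Q.equivFin.symm.injective.comp (Fin.castLE_injective hn))
  refine EmbedsIn.of_fun e he (fun x y => ?_) fun x => (Q.equivFin.symm _).2
  rw [top_adj, ← he.ne_iff]
  exact ⟨fun h => h.ne, hQ _ (Q.equivFin.symm _).2 _ (Q.equivFin.symm _).2⟩

theorem embedsIn_K1 (z : V) : EmbedsIn (K 1) G {z} := by
  simpa using embedsIn_K (n := 1) (G := G) {z} (by simp) (by simp)

theorem embedsIn_K2 {a b : V} (h : G.Adj a b) : EmbedsIn (K 2) G {a, b} := by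
  classical
  simpa using embedsIn_K (n := 2) (G := G) {a, b} (by simp [h, h.symm])
    (by rw [Finset.card_pair h.ne])

theorem embedsIn_twoK1 {a b : V} (h : ¬ G.Adj a b) (hne : a ≠ b) : EmbedsIn twoK1 G {a, b} := by
  have h' : ¬ G.Adj b a := fun hn => h hn.symm
  refine EmbedsIn.of_fun ![a, b] ?_ ?_ ?_
  · intro i j hij
    fin_cases i <;> fin_cases j <;> simp_all
  · intro i j
    fin_cases i <;> fin_cases j <;> simp_all
  · intro i
    fin_cases i <;> simp

theorem embedsIn_P3 {a b c : V} (hab : G.Adj a b) (hbc : G.Adj b c) (hac : ¬ G.Adj a c)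
    (hne : a ≠ c) : EmbedsIn (pathGraph 3) G {a, b, c} := by
  have h1 := hab.ne
  have h2 := hbc.ne
  refine EmbedsIn.of_fun ![a, b, c] ?_ ?_ ?_
  · intro i j hij
    fin_cases i <;> fin_cases j <;> simp_all
  · intro i j
    fin_cases i <;> fin_cases j <;> simp_all [pathGraph_adj, G.adj_comm]
  · intro i
    fin_cases i <;> simp

theorem embedsIn_C4 {a b c d : V} (hab : G.Adj a b) (hbc : G.Adj b c) (hcd : G.Adj c d)
    (hda : G.Adj d a) (hac : ¬ G.Adj a c) (hbd : ¬ G.Adj b d) (hac' : a ≠ c) (hbd' : b ≠ d) :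
    EmbedsIn (cycleGraph 4) G {a, b, c, d} := by
  have h1 := hab.ne
  have h2 := hbc.ne
  have h3 := hcd.ne
  have h4 := hda.ne
  refine EmbedsIn.of_fun ![a, b, c, d] ?_ ?_ ?_
  · intro i j hij
    fin_cases i <;> fin_cases j <;> simp_all
  · have e : ∀ i j : Fin 4, (cycleGraph 4).Adj i j ↔ i - j = 1 ∨ j - i = 1 := fun i j =>
      cycleGraph_adj
    intro i j
    rw [e]
    fin_cases i <;> fin_cases j <;> simp_all [G.adj_comm] <;> decide
  · intro i
    fin_cases i <;> simp

/-! ### Obstructions inside disconnected graphs -/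

theorem exists_2K2_or_C4_of_not_polarOn [Finite V] (hG : Sparse G) (hs : 1 ≤ s)
    (h : ¬ PolarOn G s Set.univ) :
    (∃ a b c d, G.Adj a b ∧ G.Adj c d ∧ ¬ G.Adj a c ∧ ¬ G.Adj a d ∧ ¬ G.Adj b c ∧ ¬ G.Adj b d) ∨
    ∃ a b c d, G.Adj a b ∧ G.Adj b c ∧ G.Adj c d ∧ G.Adj d a ∧ ¬ G.Adj a c ∧ ¬ G.Adj b d ∧
      a ≠ c ∧ b ≠ d := by
  refine exists_2K2_or_C4 hG ?_
  rintro ⟨K, hK, hI⟩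
  refine h (PolarOn.mono_right (PolarOn.of_colouring Kᶜ {0} (fun _ => 0) (by simp) (by simp)
    ?_ ?_) hs)
  · intro x _ hx y _ hy
    simpa using hI x hx y hy
  · intro x _ hx y _ hy hxy
    exact hK x (by simpa using hx) y (by simpa using hy) hxy

theorem exists_clique_of_not_polarOn [Finite V] {A : Set V} (hA : Multipartite G A)
    (hB : ∀ x, x ∉ A → ∀ y, y ∉ A → x ≠ y → G.Adj x y) (h : ¬ PolarOn G s Set.univ) :
    ∃ Q : Finset V, (∀ x ∈ Q, x ∈ A) ∧ (∀ x ∈ Q, ∀ y ∈ Q, x ≠ y → G.Adj x y) ∧ s + 1 ≤ Q.card := by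
  by_contra! hn
  refine h (polarOn_univ_of_multipartite hA (fun Q h1 h2 => ?_) hB)
  have := hn Q h1 h2
  omega

/-- In a complete multipartite set, at most one vertex of a clique is non-adjacent to `x`. -/
theorem Multipartite.exists_clique_adj {A : Set V} (hA : Multipartite G A) {x : V} (hx : x ∈ A)
    {Q : Finset V} (hQA : ∀ x ∈ Q, x ∈ A) (hQ : ∀ x ∈ Q, ∀ y ∈ Q, x ≠ y → G.Adj x y) {n : ℕ}
    (hn : n + 1 ≤ Q.card) :
    ∃ R : Finset V, R ⊆ Q ∧ (∀ y ∈ R, G.Adj x y) ∧ n ≤ R.card := by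
  classical
  refine ⟨Q.filter fun y => G.Adj x y, Finset.filter_subset _ _, fun y hy =>
    (Finset.mem_filter.1 hy).2, ?_⟩
  have h1 : (Q.filter fun y => ¬ G.Adj x y).card ≤ 1 := by
    rw [Finset.card_le_one]
    intro a ha b hb
    rw [Finset.mem_filter] at ha hb
    by_contra hab
    exact hA a (hQA a ha.1) x hx b (hQA b hb.1) (fun h => ha.2 h.symm) hb.2
      (hQ a ha.1 b hb.1 hab)
  have h2 := Finset.card_filter_add_card_filter_not (s := Q) (fun y => G.Adj x y)
  omega

theorem Multipartite.exists_P3 {A : Set V} (hA : Multipartite G A) {u v x y : V} (hu : u ∈ A)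
    (hv : v ∈ A) (hx : x ∈ A) (hy : y ∈ A) (huv : G.Adj u v) (hxy : ¬ G.Adj x y) :
    ∃ w ∈ A, G.Adj x w ∧ G.Adj w y := by
  obtain ⟨w, hw, hxw⟩ : ∃ w ∈ A, G.Adj x w := by
    by_cases hxu : G.Adj x u
    · exact ⟨u, hu, hxu⟩
    · refine ⟨v, hv, ?_⟩
      by_contra hxv
      exact hA u hu x hx v hv (fun h => hxu h.symm) hxv huv
  refine ⟨w, hw, hxw, ?_⟩
  by_contra hwy
  exact hA x hx y hy w hw hxy (fun h => hwy h.symm) hxw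

theorem embedsIn_E1 {z a b c d : V} (hab : G.Adj a b) (hcd : G.Adj c d)
    (hac : ¬ G.Adj a c) (had : ¬ G.Adj a d) (hbc : ¬ G.Adj b c) (hbd : ¬ G.Adj b d)
    (hza : ¬ G.Adj z a) (hzb : ¬ G.Adj z b) (hzc : ¬ G.Adj z c) (hzd : ¬ G.Adj z d) :
    Nonempty (E1 ↪g G) := by
  refine (EmbedsIn.sum (embedsIn_K1 z) (EmbedsIn.sum (embedsIn_K2 hab) (embedsIn_K2 hcd)
    ?_) ?_).nonempty
  · have h1 : a ≠ c := by rintro rfl; exact hbc hab.symm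
    have h2 : a ≠ d := by rintro rfl; exact hbd hab.symm
    have h3 : b ≠ c := by rintro rfl; exact hac hab
    have h4 : b ≠ d := by rintro rfl; exact had hab
    simp [*]
  · have h1 : z ≠ a := by rintro rfl; exact hzb hab
    have h2 : z ≠ b := by rintro rfl; exact hza hab.symm
    have h3 : z ≠ c := by rintro rfl; exact hzd hcd
    have h4 : z ≠ d := by rintro rfl; exact hzc hcd.symm
    simp [*]

/-- Two nontrivial sides without edges between them, one of them a clique. -/
theorem exists_obstruction_of_clique_side [Finite V]
    (hp : ¬ PolarOn G s Set.univ) {X : Set V} (hX : Multipartite G X)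
    (hXY : ∀ x ∈ X, ∀ y, y ∉ X → ¬ G.Adj x y)
    (hY : ∀ x, x ∉ X → ∀ y, y ∉ X → x ≠ y → G.Adj x y) {c d : V} (hc : c ∉ X) (hd : d ∉ X)
    (hcd : G.Adj c d) :
    Nonempty (K (s + 1) ⊕g K (s + 1) ↪g G) ∨ Nonempty (K 2 ⊕g join (K s) twoK1 ↪g G) := by
  obtain ⟨Q, hQX, hQ, hQs⟩ := exists_clique_of_not_polarOn hX hY hp
  by_cases hXc : ∀ x ∈ X, ∀ y ∈ X, x ≠ y → G.Adj x y
  · left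
    -- Both sides are cliques, so either may serve as the multipartite part; hence each has at least
    -- `s + 1` vertices.
    obtain ⟨R, hRY, hR, hRs⟩ := exists_clique_of_not_polarOn (A := Xᶜ) (s := s) (G := G)
      (fun x hx y hy z hz hxy hyz => by
        have h1 : x = y := by by_contra hn; exact hxy (hY x hx y hy hn)
        rw [h1]
        exact hyz)
      (fun x hx y hy hxy => hXc x (by simpa using hx) y (by simpa using hy) hxy) hp
    refine (EmbedsIn.sum (embedsIn_K Q hQ hQs) (embedsIn_K R hR hRs) ?_).nonempty
    intro x hx y hy
    refine ⟨?_, hXY x (hQX x hx) y (hRY y hy)⟩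
    rintro rfl
    exact hRY x hy (hQX x hx)
  · right
    push Not at hXc
    obtain ⟨x, hx, y, hy, hxy, hxy'⟩ := hXc
    -- The non-adjacent `x` and `y` lie in one part, so `s` vertices of the `(s + 1)`-clique see
    -- both.
    obtain ⟨R, hRQ, hxR, hRs⟩ := hX.exists_clique_adj hx hQX hQ hQs
    have hyR : ∀ r ∈ R, G.Adj y r := by
      intro r hr
      by_contra hyr
      exact hX x hx y hy r (hQX r (hRQ hr)) hxy' hyr (hxR r hr)
    refine (EmbedsIn.sum (embedsIn_K2 hcd) (EmbedsIn.join
      (embedsIn_K R (fun a ha b hb => hQ a (hRQ ha) b (hRQ hb)) hRs)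
      (embedsIn_twoK1 hxy' hxy) ?_) ?_).nonempty
    · rintro r hr _ (rfl | rfl)
      · exact (hxR r hr).symm
      · exact (hyR r hr).symm
    · have hX' : ∀ b ∈ (R : Set V) ∪ {x, y}, b ∈ X := by
        rintro b (hb | rfl | rfl)
        · exact hQX b (hRQ hb)
        · exact hx
        · exact hy
      intro a ha b hb
      have haX : a ∉ X := by
        rcases ha with rfl | rfl
        · exact hc
        · exact hd
      exact ⟨by rintro rfl; exact haX (hX' a hb), fun h => hXY b (hX' b hb) a haX h.symm⟩

/-- An isolated vertex together with a `C₄`. -/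
theorem exists_obstruction_of_isolated [Finite V] (hG : Sparse G) (hs : 2 ≤ s)
    (hp : ¬ PolarOn G s Set.univ) {z : V} (hz : ∀ x, ¬ G.Adj z x) {a b c d : V}
    (hab : G.Adj a b) (hbc : G.Adj b c) (hcd : G.Adj c d) (hda : G.Adj d a)
    (hac : ¬ G.Adj a c) (hbd : ¬ G.Adj b d) (hac' : a ≠ c) (hbd' : b ≠ d) :
    Nonempty (E3 ↪g G) ∨ Nonempty (E7 ↪g G) ∨
      Nonempty (K 1 ⊕g join (K (s - 1)) (cycleGraph 4) ↪g G) := by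
  by_contra! hcon
  obtain ⟨hE3, hE7, hT⟩ := hcon
  rw [← not_nonempty_iff] at hE3 hE7 hT
  have hz' : ∀ x, ¬ G.Adj x z := fun x h => hz x h.symm
  have hza : ∀ x y, G.Adj x y → z ≠ x := by rintro x y h rfl; exact hz y h
  -- `w`, the edge `u v` and two non-adjacent common neighbours `p, q` induce `E7` together with `z`
  have hE7' : ∀ w u v p q, G.Adj u v → ¬ G.Adj w u → ¬ G.Adj w v → G.Adj p u → G.Adj p v →
      G.Adj p w → G.Adj q u → G.Adj q v → G.Adj q w → ¬ G.Adj p q → p ≠ q → False := by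
    intro w u v p q huv hwu hwv hpu hpv hpw hqu hqv hqw hpq hpq'
    apply hE7
    have hwu' : w ≠ u := by rintro rfl; exact hwv huv
    have hwv' : w ≠ v := by rintro rfl; exact hwu huv.symm
    have e1 : EmbedsIn (pathGraph 3) Gᶜ {u, w, v} := embedsIn_P3
      ((compl_adj _ _ _).2 ⟨hwu'.symm, fun h => hwu h.symm⟩) ((compl_adj _ _ _).2 ⟨hwv', hwv⟩)
      (fun h => ((compl_adj _ _ _).1 h).2 huv) huv.ne
    have e2 : EmbedsIn (K 2) Gᶜ {p, q} := embedsIn_K2 ((compl_adj _ _ _).2 ⟨hpq', hpq⟩)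
    refine (EmbedsIn.sum (embedsIn_K1 z) (e1.sum e2 ?_).of_compl ?_).nonempty
    · simp [compl_adj, hpu.ne', hpv.ne', hpw.ne', hqu.ne', hqv.ne', hqw.ne', hpu.symm, hpv.symm,
        hpw.symm, hqu.symm, hqv.symm, hqw.symm]
    · simp [hz, hza u v huv, hza v u huv.symm, hza w p hpw.symm, hza p w hpw, hza q w hqw]
  -- Excluding `E3` and `E7` and using sparsity, a vertex off a `C₄` sees one opposite pair
  -- entirely, and the other pair entirely or not at all. This makes `G - z` complete multipartite.
  have hC4 : ∀ a b c d y, G.Adj a b → G.Adj b c → G.Adj c d → G.Adj d a → ¬ G.Adj a c →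
      ¬ G.Adj b d → a ≠ c → b ≠ d → y ≠ z → y ≠ a → y ≠ b → y ≠ c → y ≠ d →
      (G.Adj y a ∧ G.Adj y c ∧ (G.Adj y b ↔ G.Adj y d)) ∨
        (G.Adj y b ∧ G.Adj y d ∧ (G.Adj y a ↔ G.Adj y c)) := by
    intro a b c d y hab hbc hcd hda hac hbd hac' hbd' hyz hya hyb hyc hyd
    have hca : ¬ G.Adj c a := fun h => hac h.symm
    have hdb : ¬ G.Adj d b := fun h => hbd h.symm
    have k1 : ¬ (¬ G.Adj y a ∧ ¬ G.Adj y b ∧ ¬ G.Adj y c ∧ ¬ G.Adj y d) := by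
      rintro ⟨h1, h2, h3, h4⟩
      apply hE3
      refine (EmbedsIn.sum (embedsIn_C4 hab hbc hcd hda hac hbd hac' hbd')
        (embedsIn_twoK1 (hz y) hyz.symm) ?_).nonempty
      simp [hz', (hza a b hab).symm, (hza b c hbc).symm, (hza c d hcd).symm, (hza d a hda).symm,
        hya.symm, hyb.symm, hyc.symm, hyd.symm, G.adj_comm _ y, h1, h2, h3, h4]
    -- no vertex has one neighbour on the cycle, two consecutive ones, or three
    have key : ∀ a b c d, G.Adj a b → G.Adj b c → G.Adj c d → G.Adj d a → ¬ G.Adj a c →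
        ¬ G.Adj b d → a ≠ c → b ≠ d → y ≠ a → y ≠ b → y ≠ c → y ≠ d → G.Adj y a →
        ¬ G.Adj y d → G.Adj y c ∧ ¬ G.Adj y b := by
      intro a b c d hab hbc hcd hda hac hbd hac' hbd' hya hyb hyc hyd h1 h4
      have hca : ¬ G.Adj c a := fun h => hac h.symm
      have hdb : ¬ G.Adj d b := fun h => hbd h.symm
      have hdy : ¬ G.Adj d y := fun h => h4 h.symm
      by_cases h3 : G.Adj y c
      · refine ⟨h3, fun h2 => ?_⟩
        exact hE7' d y b a c h2 hdy hdb h1.symm hab hda.symm h3.symm hbc.symm hcd hac hac'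
      · exfalso
        have := hG y a d c b ⟨h1, hda.symm, hcd.symm, h4, hac, h3⟩ hyb.symm hab.ne' hbd' hbc.ne
        have e1 := hab.symm
        have e2 := hbc
        by_cases h2 : G.Adj y b <;> simp_all [G.adj_comm]
    have k2 := key a b c d hab hbc hcd hda hac hbd hac' hbd' hya hyb hyc hyd
    have k3 := key c d a b hcd hda hab hbc hca hdb hac'.symm hbd'.symm hyc hyd hya hyb
    have k4 := key b c d a hbc hcd hda hab hbd hca hbd' hac'.symm hyb hyc hyd hya
    have k5 := key d a b c hda hab hbc hcd hdb hac hbd'.symm hac' hyd hya hyb hyc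
    generalize G.Adj y a = A, G.Adj y b = B, G.Adj y c = C, G.Adj y d = D at k1 k2 k3 k4 k5 ⊢
    clear * - k1 k2 k3 k4 k5
    grind
  have hne : ∀ x y, G.Adj x y → x ≠ z := fun x y h => (hza x y h).symm
  have hca : ¬ G.Adj c a := fun h => hac h.symm
  have hdb : ¬ G.Adj d b := fun h => hbd h.symm
  -- every vertex but `z` is non-adjacent to `a, c`, or to `b, d`, or adjacent to all four
  have htype : ∀ y, y ≠ z → (¬ G.Adj y a ∧ ¬ G.Adj y c ∧ G.Adj y b ∧ G.Adj y d) ∨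
      (G.Adj y a ∧ G.Adj y c ∧ ¬ G.Adj y b ∧ ¬ G.Adj y d) ∨
      (G.Adj y a ∧ G.Adj y c ∧ G.Adj y b ∧ G.Adj y d) := by
    intro y hyz
    by_cases hya : y = a
    · subst hya; exact Or.inl ⟨G.loopless.irrefl _, hac, hab, hda.symm⟩
    by_cases hyb : y = b
    · subst hyb; exact Or.inr (Or.inl ⟨hab.symm, hbc, G.loopless.irrefl _, hbd⟩)
    by_cases hyc : y = c
    · subst hyc; exact Or.inl ⟨hca, G.loopless.irrefl _, hbc.symm, hcd⟩
    by_cases hyd : y = d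
    · subst hyd; exact Or.inr (Or.inl ⟨hda, hcd.symm, hdb, G.loopless.irrefl _⟩)
    have := hC4 a b c d y hab hbc hcd hda hac hbd hac' hbd' hyz hya hyb hyc hyd
    tauto
  -- the non-neighbours of a vertex `y` on the side of `a, c` are exactly the vertices of that side
  have hside : ∀ a b c d, G.Adj a b → G.Adj b c → G.Adj c d → G.Adj d a → ¬ G.Adj a c →
      ¬ G.Adj b d → a ≠ c → b ≠ d → ∀ y, y ≠ z → ¬ G.Adj y a → ¬ G.Adj y c → G.Adj y b →
      G.Adj y d → ∀ x, x ≠ z → (¬ G.Adj x y ↔ ¬ G.Adj x a ∧ ¬ G.Adj x c) := by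
    intro a b c d hab hbc hcd hda hac hbd hac' hbd' y hyz hya hyc hyb hyd x hxz
    have hca : ¬ G.Adj c a := fun h => hac h.symm
    have hdb : ¬ G.Adj d b := fun h => hbd h.symm
    have hay : ¬ G.Adj a y := fun h => hya h.symm
    have hcy : ¬ G.Adj c y := fun h => hyc h.symm
    constructor
    · intro hxy
      by_cases hxa : x = a
      · subst hxa; exact ⟨G.loopless.irrefl _, hac⟩
      by_cases hxc : x = c
      · subst hxc; exact ⟨hca, G.loopless.irrefl _⟩
      by_cases hxyeq : x = y
      · subst hxyeq; exact ⟨hya, hyc⟩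
      have hxb : x ≠ b := by rintro rfl; exact hxy hyb.symm
      have hxd : x ≠ d := by rintro rfl; exact hxy hyd.symm
      by_cases hya' : y = a
      · subst hya'
        have := hC4 y b c d x hab hbc hcd hda hac hbd hac' hbd' hxz hxyeq hxb hxc hxd
        tauto
      by_cases hyc' : y = c
      · subst hyc'
        have := hC4 a b y d x hab hbc hcd hda hac hbd hac' hbd' hxz hxa hxb hxyeq hxd
        tauto
      have h1 := hC4 y b c d x hyb hbc hcd hyd.symm hyc hbd hyc' hbd' hxz hxyeq hxb hxc hxd
      have h2 := hC4 y b a d x hyb hab.symm hda.symm hyd.symm hya hbd hya' hbd' hxz hxyeq hxb hxa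
        hxd
      tauto
    · rintro ⟨hxa, hxc⟩ hxy
      by_cases hxa' : x = a
      · subst hxa'; exact hya hxy.symm
      by_cases hxc' : x = c
      · subst hxc'; exact hyc hxy.symm
      have hxb : x ≠ b := by rintro rfl; exact hxa hab.symm
      have hxd : x ≠ d := by rintro rfl; exact hxa hda
      have h1 := hC4 a b c d x hab hbc hcd hda hac hbd hac' hbd' hxz hxa' hxb hxc' hxd
      refine hE7' a x y b d hxy (fun h => hxa h.symm) hay ?_ hyb.symm hab.symm ?_ hyd.symm hda
        hbd hbd'
      · exact G.adj_symm (by tauto)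
      · exact G.adj_symm (by tauto)
  have hM : Multipartite G {x | x ≠ z} := by
    intro x hx y hy w hw hxy hyw hxw
    have hwy : ¬ G.Adj w y := fun h => hyw h.symm
    rcases htype y hy with h | h | h
    · have h1 := hside a b c d hab hbc hcd hda hac hbd hac' hbd' y hy h.1 h.2.1 h.2.2.1 h.2.2.2
      have h2 := (h1 x hx).1 hxy
      have h3 := (h1 w hw).1 hwy
      have h4 := htype w hw
      exact (hside a b c d hab hbc hcd hda hac hbd hac' hbd' w hw h3.1 h3.2 (by tauto) (by tauto)
        x hx).2 h2 hxw
    · have h1 := hside b c d a hbc hcd hda hab hbd hca hbd' hac'.symm y hy h.2.2.1 h.2.2.2 h.2.1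
        h.1
      have h2 := (h1 x hx).1 hxy
      have h3 := (h1 w hw).1 hwy
      have h4 := htype w hw
      exact (hside b c d a hbc hcd hda hab hbd hca hbd' hac'.symm w hw h3.1 h3.2 (by tauto)
        (by tauto) x hx).2 h2 hxw
    · have hfull : ∀ t, t ≠ z → ¬ G.Adj t y → G.Adj t a ∧ G.Adj t c := by
        intro t ht hty
        rcases htype t ht with h' | h' | h'
        · have := (hside a b c d hab hbc hcd hda hac hbd hac' hbd' t ht h'.1 h'.2.1 h'.2.2.1
            h'.2.2.2 y hy).1 (fun h => hty h.symm)
          tauto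
        · exact ⟨h'.1, h'.2.1⟩
        · exact ⟨h'.1, h'.2.1⟩
      obtain ⟨hxa, hxc⟩ := hfull x hx hxy
      obtain ⟨hwa, hwc⟩ := hfull w hw hwy
      exact hE7' y x w a c hxw (fun h => hxy h.symm) hyw hxa.symm hwa.symm h.1.symm hxc.symm
        hwc.symm h.2.1.symm hac hac'
  obtain ⟨Q, hQX, hQ, hQs⟩ := exists_clique_of_not_polarOn hM (by
    intro x hx y hy hxy
    simp only [Set.mem_ofPred_eq, not_not] at hx hy
    exact absurd (hx.trans hy.symm) hxy) hp
  have haz := hne a b hab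
  have hbz := hne b c hbc
  have hcz := hne c d hcd
  have hdz := hne d a hda
  -- The parts of `a` and of `b` cost the clique at most one vertex each: `s + 1`, then `s`, then `s
  -- - 1`. What remains is joined to the whole `C₄`.
  obtain ⟨R, hRQ, haR, hRs⟩ := hM.exists_clique_adj haz hQX hQ hQs
  obtain ⟨R', hRR, hbR, hRs'⟩ := hM.exists_clique_adj hbz (fun x hx => hQX x (hRQ hx))
    (fun x hx y hy => hQ x (hRQ hx) y (hRQ hy)) (n := s - 1) (by omega)
  apply hT
  refine (EmbedsIn.sum (embedsIn_K1 z) (EmbedsIn.join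
    (embedsIn_K R' (fun x hx y hy => hQ x (hRQ (hRR hx)) y (hRQ (hRR hy))) hRs')
    (embedsIn_C4 hab hbc hcd hda hac hbd hac' hbd') ?_) ?_).nonempty
  · have hR : ∀ r ∈ R', r ≠ z := fun r hr => hQX r (hRQ (hRR hr))
    rintro r hr _ (rfl | rfl | rfl | rfl)
    · exact (haR r (hRR hr)).symm
    · exact (hbR r hr).symm
    · by_contra hn
      exact hM a haz _ hcz r (hR r hr) hac (fun h => hn h.symm) (haR r (hRR hr))
    · by_contra hn
      exact hM b hbz _ hdz r (hR r hr) hbd (fun h => hn h.symm) (hbR r hr)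
  · rintro x rfl y hy
    refine ⟨?_, hz y⟩
    rcases hy with hy | rfl | rfl | rfl | rfl
    · exact (hQX y (hRQ (hRR hy))).symm
    · exact haz.symm
    · exact hbz.symm
    · exact hcz.symm
    · exact hdz.symm

/-- If two components have edges, excluding `E1` makes both sides complete multipartite; either one
side is a clique or both contain a `P₃`. Otherwise there is an isolated vertex, and since `G` is not
split it contains a `2K₂`, giving `E1`, or a `C₄`. -/
theorem exists_obstruction [Finite V] (hG : Sparse G) (hd : ¬ G.Preconnected) (hs : 2 ≤ s)
    (hp : ¬ PolarOn G s Set.univ) :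
    Nonempty (E1 ↪g G) ∨ Nonempty (E2 ↪g G) ∨ Nonempty (E3 ↪g G) ∨ Nonempty (E7 ↪g G) ∨
    Nonempty (K (s + 1) ⊕g K (s + 1) ↪g G) ∨ Nonempty (K 2 ⊕g join (K s) twoK1 ↪g G) ∨
      Nonempty (K 1 ⊕g join (K (s - 1)) (cycleGraph 4) ↪g G) := by
  by_contra! hcon
  obtain ⟨hE1, hE2, hE3, hE7, hT1, hT2, hT3⟩ := hcon
  rw [← not_nonempty_iff] at hE1 hE2 hE3 hE7 hT1 hT2 hT3
  by_cases hcase : ∃ a b c d, G.Adj a b ∧ G.Adj c d ∧ ¬ G.Reachable a c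
  · obtain ⟨a, b, c, d, hab, hcd, hac⟩ := hcase
    have hXY : ∀ x, G.Reachable a x → ∀ y, ¬ G.Reachable a y → ¬ G.Adj x y :=
      fun x hx y hy h => hy (hx.trans h.reachable)
    have hbX : G.Reachable a b := hab.reachable
    have hdX : ¬ G.Reachable a d := fun h => hac (h.trans hcd.symm.reachable)
    -- A failure of transitivity is an induced `K₁ + K₂`, which with the edge on the other side
    -- gives `E1`.
    have hX : Multipartite G {x | G.Reachable a x} := by
      intro x hx y hy z hz hxy hyz hxz
      exact hE1 (embedsIn_E1 hxz hcd (hXY x hx c hac) (hXY x hx d hdX) (hXY z hz c hac)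
        (hXY z hz d hdX) (fun h => hxy h.symm) hyz (hXY y hy c hac) (hXY y hy d hdX))
    have hY : Multipartite G {x | ¬ G.Reachable a x} := by
      intro x hx y hy z hz hxy hyz hxz
      exact hE1 (embedsIn_E1 hxz hab (fun h => hXY a .rfl x hx h.symm)
        (fun h => hXY b hbX x hx h.symm) (fun h => hXY a .rfl z hz h.symm)
        (fun h => hXY b hbX z hz h.symm) (fun h => hxy h.symm) hyz
        (fun h => hXY a .rfl y hy h.symm) (fun h => hXY b hbX y hy h.symm))
    by_cases hYc : ∀ x, ¬ G.Reachable a x → ∀ y, ¬ G.Reachable a y → x ≠ y → G.Adj x y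
    · exact (exists_obstruction_of_clique_side hp hX hXY hYc hac hdX hcd).elim hT1 hT2
    by_cases hXc : ∀ x, G.Reachable a x → ∀ y, G.Reachable a y → x ≠ y → G.Adj x y
    · refine (exists_obstruction_of_clique_side hp hY
        (fun x hx y hy h => hXY y (by simpa using hy) x hx h.symm)
        (fun x hx y hy => hXc x (by simpa using hx) y (by simpa using hy)) (c := a) (d := b)
        (by simp) (by simpa using hbX) hab).elim hT1 hT2
    push Not at hXc hYc
    obtain ⟨x, hx, x', hx', hxx, hxx'⟩ := hXc
    obtain ⟨y, hy, y', hy', hyy, hyy'⟩ := hYc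
    obtain ⟨w, hw, hxw, hwx⟩ := hX.exists_P3 (u := a) (v := b) .rfl hbX hx hx' hab hxx'
    obtain ⟨t, ht, hyt, hty⟩ := hY.exists_P3 (u := c) (v := d) hac hdX hy hy' hcd hyy'
    refine hE2 (EmbedsIn.sum (embedsIn_P3 hxw hwx hxx' hxx)
      (embedsIn_P3 hyt hty hyy' hyy) ?_).nonempty
    have h1 : ∀ p ∈ ({x, w, x'} : Set V), G.Reachable a p := by
      rintro p (rfl | rfl | rfl) <;> assumption
    have h2 : ∀ p ∈ ({y, t, y'} : Set V), ¬ G.Reachable a p := by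
      rintro p (rfl | rfl | rfl) <;> assumption
    intro p hp' q hq
    refine ⟨?_, hXY p (h1 p hp') q (h2 q hq)⟩
    rintro rfl
    exact h2 p hq (h1 p hp')
  · push Not at hcase
    have hiso : ∀ u v, G.Adj u v → ∃ z, ∀ x, ¬ G.Adj z x := by
      intro u v huv
      by_contra! hn
      apply hd
      intro x y
      obtain ⟨x', hx'⟩ := hn x
      obtain ⟨y', hy'⟩ := hn y
      exact hcase x x' y y' hx' hy'
    rcases exists_2K2_or_C4_of_not_polarOn hG (by omega) hp with
      ⟨a, b, c, d, hab, hcd, hac, had, hbc, hbd⟩ |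
      ⟨a, b, c, d, hab, hbc, hcd, hda, hac, hbd, hac', hbd'⟩
    · obtain ⟨z, hz⟩ := hiso a b hab
      exact hE1 (embedsIn_E1 hab hcd hac had hbc hbd (hz a) (hz b) (hz c) (hz d))
    · obtain ⟨z, hz⟩ := hiso a b hab
      exact (exists_obstruction_of_isolated hG hs hp hz hab hbc hcd hda hac hbd hac' hbd').elim
        hE3 fun h => h.elim hE7 hT3

/-! ### Graphs that are not polar -/

theorem card_le_of_clique {α : Type*} [Fintype α] {f : V → ℕ} (q : α → V)
    (hq : ∀ i, f (q i) < s) (hinj : ∀ i j, i ≠ j → f (q i) ≠ f (q j)) : Fintype.card α ≤ s := by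
  have h : Function.Injective fun i => (⟨f (q i), hq i⟩ : Fin s) := by
    intro i j hij
    by_contra hne
    exact hinj i j hne (by simpa using hij)
  simpa using Fintype.card_le_of_injective _ h

theorem PolarOn.split_of_one (h : PolarOn G 1 Set.univ) :
    ∃ K : Set V, (∀ x ∈ K, ∀ y ∈ K, x ≠ y → G.Adj x y) ∧ ∀ x, x ∉ K → ∀ y, y ∉ K → ¬ G.Adj x y := by
  obtain ⟨A, f, h1, h2, h3⟩ := h
  refine ⟨Aᶜ, fun x hx y hy => h3 x trivial hx y trivial hy, fun x hx y hy hxy => ?_⟩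
  simp only [Set.mem_compl_iff, not_not] at hx hy
  have e1 := h1 x trivial hx
  have e2 := h1 y trivial hy
  have e3 := (h2 x trivial hx y trivial hy).1 hxy
  omega

/-- An isolated vertex in the multipartite part makes that part independent; in the clique part it
is the entire clique. -/
theorem PolarOn.of_isolated (h : PolarOn G s Set.univ) {z : V} (hz : ∀ x, ¬ G.Adj z x) :
    (∃ f : V → ℕ, (∀ x, x ≠ z → f x < s) ∧
      ∀ x, x ≠ z → ∀ y, y ≠ z → (G.Adj x y ↔ f x ≠ f y)) ∨
    ∃ K : Set V, (∀ x ∈ K, ∀ y ∈ K, x ≠ y → G.Adj x y) ∧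
      ∀ x, x ∉ K → ∀ y, y ∉ K → ¬ G.Adj x y := by
  obtain ⟨A, f, h1, h2, h3⟩ := h
  by_cases hzA : z ∈ A
  · right
    refine ⟨Aᶜ, fun x hx y hy => h3 x trivial hx y trivial hy, fun x hx y hy hxy => ?_⟩
    simp only [Set.mem_compl_iff, not_not] at hx hy
    have e1 := h2 z trivial hzA x trivial hx
    have e2 := h2 z trivial hzA y trivial hy
    have e3 := (h2 x trivial hx y trivial hy).1 hxy
    simp_all
  · left
    have hA : ∀ x, x ≠ z → x ∈ A := by
      intro x hx
      by_contra hxA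
      exact hz x (h3 z trivial hzA x trivial hxA hx.symm)
    exact ⟨f, fun x hx => h1 x trivial (hA x hx),
      fun x hx y hy => h2 x trivial (hA x hx) y trivial (hA y hy)⟩

theorem not_split_of_C4 {a b c d : V} (hab : G.Adj a b) (hbc : G.Adj b c) (hcd : G.Adj c d)
    (hda : G.Adj d a) (hac : ¬ G.Adj a c) (hbd : ¬ G.Adj b d) (hac' : a ≠ c) (hbd' : b ≠ d) :
    ¬ ∃ K : Set V, (∀ x ∈ K, ∀ y ∈ K, x ≠ y → G.Adj x y) ∧
      ∀ x, x ∉ K → ∀ y, y ∉ K → ¬ G.Adj x y := by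
  rintro ⟨K, hK, hI⟩
  have k1 := fun h1 h2 => hac (hK a h1 c h2 hac')
  have k2 := fun h1 h2 => hbd (hK b h1 d h2 hbd')
  have k3 := fun h1 h2 => hI a h1 b h2 hab
  have k4 := fun h1 h2 => hI b h1 c h2 hbc
  have k5 := fun h1 h2 => hI c h1 d h2 hcd
  have k6 := fun h1 h2 => hI d h1 a h2 hda
  tauto

theorem not_split_of_2K2 {a b c d : V} (hab : G.Adj a b) (hcd : G.Adj c d) (hac : ¬ G.Adj a c)
    (had : ¬ G.Adj a d) (hbc : ¬ G.Adj b c) (hbd : ¬ G.Adj b d) :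
    ¬ ∃ K : Set V, (∀ x ∈ K, ∀ y ∈ K, x ≠ y → G.Adj x y) ∧
      ∀ x, x ∉ K → ∀ y, y ∉ K → ¬ G.Adj x y := by
  rintro ⟨K, hK, hI⟩
  have h1 : a ≠ c := by rintro rfl; exact hbc hab.symm
  have h2 : a ≠ d := by rintro rfl; exact hbd hab.symm
  have h3 : b ≠ c := by rintro rfl; exact hac hab
  have h4 : b ≠ d := by rintro rfl; exact had hab
  have k1 := fun h1' h2 => hac (hK a h1' c h2 h1)
  have k2 := fun h1 h2' => had (hK a h1 d h2' h2)
  have k3 := fun h1 h2 => hbc (hK b h1 c h2 h3)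
  have k4 := fun h1 h2 => hbd (hK b h1 d h2 h4)
  have k5 := fun h1 h2 => hI a h1 b h2 hab
  have k6 := fun h1 h2 => hI c h1 d h2 hcd
  tauto

theorem not_polarOn_of_isolated {z a b c : V} (hz : ∀ x, ¬ G.Adj z x) (hab : G.Adj a b)
    (hac : ¬ G.Adj a c) (hbc : ¬ G.Adj b c) (hcz : c ≠ z)
    (hsplit : ¬ ∃ K : Set V, (∀ x ∈ K, ∀ y ∈ K, x ≠ y → G.Adj x y) ∧
      ∀ x, x ∉ K → ∀ y, y ∉ K → ¬ G.Adj x y) : ¬ PolarOn G s Set.univ := by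
  intro h
  rcases h.of_isolated hz with ⟨f, -, hf⟩ | h
  · have haz : a ≠ z := by rintro rfl; exact hz b hab
    have hbz : b ≠ z := by rintro rfl; exact hz a hab.symm
    have e1 := hf a haz b hbz
    have e2 := hf a haz c hcz
    have e3 := hf b hbz c hcz
    simp_all
  · exact hsplit h

instance sumAdjDecidable [DecidableRel G.Adj] [DecidableRel H.Adj] :
    DecidableRel (G ⊕g H).Adj
  | Sum.inl u, Sum.inl v => decidable_of_iff (G.Adj u v) (by simp)
  | Sum.inr u, Sum.inr v => decidable_of_iff (H.Adj u v) (by simp)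
  | Sum.inl _, Sum.inr _ => isFalse (by simp)
  | Sum.inr _, Sum.inl _ => isFalse (by simp)

instance pathGraphAdjDecidable (n : ℕ) : DecidableRel (pathGraph n).Adj := fun _ _ =>
  decidable_of_iff _ pathGraph_adj.symm

instance cycleGraphAdjDecidable (n : ℕ) : DecidableRel (cycleGraph (n + 2)).Adj := fun _ _ =>
  decidable_of_iff _ cycleGraph_adj.symm

instance bannerAdjDecidable : DecidableRel banner.Adj := by
  unfold banner
  infer_instance

theorem not_polarOn_E1 : ¬ PolarOn E1 s Set.univ :=
  not_polarOn_of_isolated (z := .inl 0) (a := .inr (.inl 0)) (b := .inr (.inl 1))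
    (c := .inr (.inr 0)) (by decide) (by decide) (by decide) (by decide) (by decide)
    (not_split_of_2K2 (a := .inr (.inl 0)) (b := .inr (.inl 1)) (c := .inr (.inr 0))
      (d := .inr (.inr 1)) (by decide) (by decide) (by decide) (by decide) (by decide) (by decide))

/-- The clique part lies within one `P₃` and misses one of its ends, so `A` contains the other `P₃`
and that end, hence an induced `K₂ + K₁`. -/
theorem not_polarOn_E2 : ¬ PolarOn E2 s Set.univ := by
  rintro ⟨A, f, h1, h2, h3⟩
  have side : ∀ i j, Sum.inl i ∈ A ∨ Sum.inr j ∈ A := by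
    intro i j
    by_contra! hn
    have := h3 _ trivial hn.1 _ trivial hn.2 (by simp)
    simp at this
  have hl : Sum.inl 0 ∈ A ∨ Sum.inl 2 ∈ A := by
    by_contra! hn
    have := h3 _ trivial hn.1 _ trivial hn.2 (by simp)
    revert this
    decide
  have hr : Sum.inr 0 ∈ A ∨ Sum.inr 2 ∈ A := by
    by_contra! hn
    have := h3 _ trivial hn.1 _ trivial hn.2 (by simp)
    revert this
    decide
  have tri : ∀ x y z, E2.Adj x y → ¬ E2.Adj x z → ¬ E2.Adj y z → x ∈ A → y ∈ A → z ∉ A := by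
    intro x y z hxy hxz hyz hx hy hz
    have e1 := h2 x trivial hx y trivial hy
    have e2 := h2 x trivial hx z trivial hz
    have e3 := h2 y trivial hy z trivial hz
    simp_all
  have t1 := tri (.inl 0) (.inl 1) (.inr 0) (by decide) (by decide) (by decide)
  have t2 := tri (.inl 0) (.inl 1) (.inr 2) (by decide) (by decide) (by decide)
  have t3 := tri (.inr 0) (.inr 1) (.inl 0) (by decide) (by decide) (by decide)
  have t4 := tri (.inr 0) (.inr 1) (.inl 2) (by decide) (by decide) (by decide)
  have s00 := side 0 0
  have s01 := side 0 1
  have s10 := side 1 0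
  have s11 := side 1 1
  clear side tri h1 h2 h3
  grind

theorem not_polarOn_E3 : ¬ PolarOn E3 s Set.univ :=
  not_polarOn_of_isolated (z := .inr 0) (a := .inl 0) (b := .inl 1)
    (c := .inr 1) (by decide) (by decide) (by decide) (by decide) (by decide)
    (not_split_of_C4 (a := .inl 0) (b := .inl 1) (c := .inl 2)
      (d := .inl 3) (by decide) (by decide) (by decide) (by decide) (by decide) (by decide)
      (by decide) (by decide))

theorem not_polarOn_E7 : ¬ PolarOn E7 s Set.univ :=
  not_polarOn_of_isolated (z := .inl 0) (a := .inr (.inl 0)) (b := .inr (.inl 2))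
    (c := .inr (.inl 1)) (by decide) (by decide) (by decide) (by decide) (by decide)
    (not_split_of_C4 (a := .inr (.inl 0)) (b := .inr (.inr 0)) (c := .inr (.inl 1))
      (d := .inr (.inr 1)) (by decide) (by decide) (by decide) (by decide) (by decide) (by decide)
      (by decide) (by decide))

theorem not_polarOn_T1 : ¬ PolarOn (K (s + 1) ⊕g K (s + 1)) s Set.univ := by
  rintro ⟨A, f, h1, h2, h3⟩
  have key : (∀ i, Sum.inl i ∈ A) ∨ ∀ i, Sum.inr i ∈ A := by
    by_contra! hn
    obtain ⟨⟨i, hi⟩, j, hj⟩ := hn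
    have := h3 _ trivial hi _ trivial hj (by simp)
    simp at this
  rcases key with h | h
  · have := card_le_of_clique (f := f) (s := s) _ (fun i => h1 _ trivial (h i))
      (fun i j hij => (h2 _ trivial (h i) _ trivial (h j)).1 (by simpa using hij))
    simp at this
  · have := card_le_of_clique (f := f) (s := s) _ (fun i => h1 _ trivial (h i))
      (fun i j hij => (h2 _ trivial (h i) _ trivial (h j)).1 (by simpa using hij))
    simp at this

/-- If `A` contains the whole join, it contains a clique of size `s + 1`. Otherwise the clique part
lies in the join, so `A` contains the `K₂` and, isolated from it, one of the two non-adjacent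
vertices. -/
theorem not_polarOn_T2 : ¬ PolarOn (K 2 ⊕g join (K s) twoK1) s Set.univ := by
  rintro ⟨A, f, h1, h2, h3⟩
  by_cases h : ∀ i, Sum.inr i ∈ A
  · have := card_le_of_clique (f := f) (s := s)
      (fun i : Fin s ⊕ Fin 1 => Sum.inr (i.map id fun _ => (0 : Fin 2)))
      (fun i => h1 _ trivial (h _)) (fun i j hij => (h2 _ trivial (h _) _ trivial (h _)).1 (by
        rcases i with i | i <;> rcases j with j | j
        · simpa [join] using hij
        · simp [join]
        · simp [join]
        · exact absurd (congrArg Sum.inr (Subsingleton.elim i j)) hij))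
    simp at this
  · push Not at h
    obtain ⟨j, hj⟩ := h
    have hl : ∀ i, Sum.inl i ∈ A := by
      intro i
      by_contra hi
      have := h3 _ trivial hi _ trivial hj (by simp)
      simp at this
    obtain ⟨t, ht⟩ : ∃ t, Sum.inr t ∈ A := by
      by_contra! hn
      have := h3 _ trivial (hn (.inr 0)) _ trivial (hn (.inr 1)) (by simp)
      simp [join] at this
    have e1 := h2 _ trivial (hl 0) _ trivial (hl 1)
    have e2 := h2 _ trivial (hl 0) _ trivial ht
    have e3 := h2 _ trivial (hl 1) _ trivial ht
    simp only [SimpleGraph.sum_adj_inl, top_adj, ne_eq, Fin.zero_eq_one_iff] at e1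
    simp at e1 e2 e3
    omega

/-- The `C₄` excludes a split partition, so all but the isolated vertex would have `s` parts; but
`K_{s-1}` and an edge of the `C₄` form a clique of size `s + 1`. -/
theorem not_polarOn_T3 (hs : 1 ≤ s) :
    ¬ PolarOn (K 1 ⊕g join (K (s - 1)) (cycleGraph 4)) s Set.univ := by
  intro h
  have hc : ∀ i j, (K 1 ⊕g join (K (s - 1)) (cycleGraph 4)).Adj (.inr (.inr i)) (.inr (.inr j)) ↔
      (cycleGraph 4).Adj i j := by
    intro i j
    simp [join]
  rcases h.of_isolated (z := .inl 0)
    (by rintro (x | x)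
        · exact fun h => h.ne (Subsingleton.elim (0 : Fin 1) x ▸ rfl)
        · simp) with ⟨f, h1, h2⟩ | h
  · have := card_le_of_clique (f := f) (s := s)
      (fun i : Fin (s - 1) ⊕ Fin 2 => Sum.inr (i.map id (Fin.castLE (by norm_num : 2 ≤ 4))))
      (fun i => h1 _ (by simp)) (fun i j hij => (h2 _ (by simp) _ (by simp)).1 (by
        rcases i with i | i <;> rcases j with j | j
        · simp_all [join]
        · simp [join]
        · simp [join]
        · simp only [Sum.map_inr]
          rw [hc]
          have hne : i ≠ j := by simpa using hij
          clear * - hne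
          revert i j
          decide))
    simp at this
    omega
  · refine not_split_of_C4 (a := .inr (.inr 0)) (b := .inr (.inr 1)) (c := .inr (.inr 2))
      (d := .inr (.inr 3)) ?_ ?_ ?_ ?_ ?_ ?_ ?_ ?_ h
    all_goals first | (rw [hc]; decide) | simp

/-! ### Minimality -/

instance E7AdjDecidable : DecidableRel E7.Adj :=
  inferInstanceAs (DecidableRel (K 1 ⊕g (pathGraph 3 ⊕g K 2)ᶜ).Adj)

/-- Off `v`, the colour `2` marks a clique and `0, 1` the parts of a complete multipartite graph. -/
def IsDeletionColouring (G : SimpleGraph V) (v : V) (c : V → Fin 3) : Prop :=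
  ∀ x y, x ≠ v → y ≠ v → x ≠ y → (c x = 2 → c y = 2 → G.Adj x y) ∧
      (c x ≠ 2 → c y ≠ 2 → (G.Adj x y ↔ c x ≠ c y))

instance deletionColouringDecidable [Fintype V] [DecidableEq V] [DecidableRel G.Adj] (v : V)
    (c : V → Fin 3) : Decidable (IsDeletionColouring G v c) := by
  unfold IsDeletionColouring
  infer_instance

theorem polarOn_delete_of_colouring (hs : 2 ≤ s) {v : V} (c : V → Fin 3)
    (h : IsDeletionColouring G v c) : PolarOn G s {v}ᶜ := by
  refine PolarOn.of_colouring {x | c x ≠ 2} {0, 1} c hs ?_ ?_ ?_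
  · intro x _ (hx : c x ≠ 2)
    generalize c x = i at hx
    revert i
    decide
  · intro x hx hxA y hy hyA
    by_cases hxy : x = y
    · simp [hxy]
    · exact (h x y hx hy hxy).2 hxA hyA
  · intro x hx hxA y hy hyA hxy
    exact (h x y hx hy hxy).1 (by simpa using hxA) (by simpa using hyA)

theorem isMinimalPolarObstruction_E1 (hs : 2 ≤ s) : IsMinimalPolarObstruction s 1 E1 := by
  refine isMinimalPolarObstruction_of_delete not_polarOn_E1 fun v =>
    polarOn_delete_of_colouring hs (match v with
      | .inl _ => fun
        | .inr (.inl _) => 2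
        | .inr (.inr i) => i.castSucc
        | _ => 0
      | .inr (.inl _) => fun
        | .inr (.inr 1) => 2
        | _ => 0
      | .inr (.inr _) => fun
        | .inr (.inl 1) => 2
        | _ => 0) ?_
  revert v
  decide

theorem isMinimalPolarObstruction_E2 (hs : 2 ≤ s) : IsMinimalPolarObstruction s 1 E2 := by
  refine isMinimalPolarObstruction_of_delete not_polarOn_E2 fun v =>
    polarOn_delete_of_colouring hs (match v with
      | .inl 1 => fun
        | .inr 1 => 2
        | _ => 0
      | .inr 1 => fun
        | .inl 1 => 2
        | _ => 0
      | .inl _ => fun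
        | .inl _ => 2
        | .inr 1 => 1
        | _ => 0
      | .inr _ => fun
        | .inr _ => 2
        | .inl 1 => 1
        | _ => 0) ?_
  revert v
  decide

theorem isMinimalPolarObstruction_E3 (hs : 2 ≤ s) : IsMinimalPolarObstruction s 1 E3 := by
  refine isMinimalPolarObstruction_of_delete not_polarOn_E3 fun v =>
    polarOn_delete_of_colouring hs (match v with
      | .inl i => fun
        | .inl j => if j = i + 2 then 2 else 0
        | _ => 0
      | .inr _ => fun
        | .inl i => if i = 0 ∨ i = 2 then 0 else 1
        | .inr _ => 2) ?_
  revert v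
  decide

theorem isMinimalPolarObstruction_E7 (hs : 2 ≤ s) : IsMinimalPolarObstruction s 1 E7 := by
  refine isMinimalPolarObstruction_of_delete not_polarOn_E7 fun v =>
    polarOn_delete_of_colouring hs (match v with
      | .inl _ => fun
        | .inr (.inl i) => if i = 1 then 0 else 2
        | _ => 1
      | .inr (.inl i) => if i = 1 then fun
          | .inr (.inl _) => 2
          | _ => 0
        else fun
          | .inl _ => 2
          | .inr (.inl _) => 0
          | .inr (.inr _) => 1
      | .inr (.inr _) => fun
        | .inr (.inl i) => if i = 1 then 0 else 2
        | .inl _ => 0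
        | .inr (.inr _) => 2) ?_
  revert v
  decide

theorem isMinimalPolarObstruction_T1 : IsMinimalPolarObstruction s 1 (K (s + 1) ⊕g K (s + 1)) := by
  refine isMinimalPolarObstruction_of_delete not_polarOn_T1 ?_
  rintro (v | v)
  · refine PolarOn.of_colouring {x | x.isLeft} (Finset.univ.erase v) (Sum.elim id id)
      (by simp) ?_ ?_ ?_
    · rintro (x | x) hx hxA <;> simp_all
    · rintro (x | x) hx hxA (y | y) hy hyA <;> simp_all
    · rintro (x | x) hx hxA (y | y) hy hyA hxy <;> simp_all
  · refine PolarOn.of_colouring {x | x.isRight} (Finset.univ.erase v) (Sum.elim id id)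
      (by simp) ?_ ?_ ?_
    · rintro (x | x) hx hxA <;> simp_all
    · rintro (x | x) hx hxA (y | y) hy hyA <;> simp_all
    · rintro (x | x) hx hxA (y | y) hy hyA hxy <;> simp_all

theorem polarOn_succ_T1 : PolarOn (K (s + 1) ⊕g K (s + 1)) (s + 1) Set.univ := by
  refine PolarOn.of_colouring {x | x.isLeft} Finset.univ (Sum.elim id id) (by simp) ?_ ?_ ?_
  · rintro (x | x) hx hxA <;> simp_all
  · rintro (x | x) hx hxA (y | y) hy hyA <;> simp_all
  · rintro (x | x) hx hxA (y | y) hy hyA hxy <;> simp_all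

theorem isMinimalPolarObstruction_T2 (hs : 2 ≤ s) :
    IsMinimalPolarObstruction s 1 (K 2 ⊕g join (K s) twoK1) := by
  refine isMinimalPolarObstruction_of_delete not_polarOn_T2 ?_
  rintro (v | v | v)
  -- The clique is `K_s`; the surviving vertex of `K₂` and the two vertices of `2K₁` are
  -- independent.
  · refine PolarOn.of_colouring {x | ∀ i, x ≠ .inr (.inl i)} {0} (fun _ => (0 : Fin 1))
      (by simp; omega) (by simp) ?_ ?_
    · rintro (x | x | x) hx hxA (y | y | y) hy hyA <;> simp_all [join]
      omega
    · rintro (x | x | x) hx hxA (y | y | y) hy hyA hxy <;> simp_all [join]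
  -- The join without `v` has `s` parts: `s - 1` singletons, and `2K₁` under the colour `none`.
  · refine PolarOn.of_colouring {x | x.isRight} (Finset.univ.erase (some v))
      (Sum.elim (fun _ => none) (Sum.elim some fun _ => none)) (by simp) ?_ ?_ ?_
    · rintro (x | x | x) hx hxA <;> simp_all
    · rintro (x | x | x) hx hxA (y | y | y) hy hyA <;> simp_all [join]
    · rintro (x | x | x) hx hxA (y | y | y) hy hyA hxy <;> simp_all [join]
  · refine PolarOn.of_colouring {x | x.isLeft} Finset.univ
      (Sum.elim id fun _ => 0) (by simpa using hs) (by simp) ?_ ?_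
    · rintro (x | x | x) hx hxA (y | y | y) hy hyA <;> simp_all
    · rintro (x | x | x) hx hxA (y | y | y) hy hyA hxy <;> simp_all [join]
      omega

theorem polarOn_succ_T2 : PolarOn (K 2 ⊕g join (K s) twoK1) (s + 1) Set.univ := by
  refine PolarOn.of_colouring {x | x.isRight} Finset.univ
    (Sum.elim (fun _ => none) (Sum.elim some fun _ => none)) (by simp) (by simp) ?_ ?_
  · rintro (x | x | x) hx hxA (y | y | y) hy hyA <;> simp_all [join]
  · rintro (x | x | x) hx hxA (y | y | y) hy hyA hxy <;> simp_all [join]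

theorem cycleGraph_four_adj_iff (x y : Fin 4) :
    (cycleGraph 4).Adj x y ↔ decide (x = 0 ∨ x = 2) ≠ decide (y = 0 ∨ y = 2) := by
  revert x y
  decide

theorem isMinimalPolarObstruction_T3 (hs : 2 ≤ s) :
    IsMinimalPolarObstruction s 1 (K 1 ⊕g join (K (s - 1)) (cycleGraph 4)) := by
  refine isMinimalPolarObstruction_of_delete (not_polarOn_T3 (by omega)) ?_
  rintro (v | v | v)
  -- An edge of the `C₄` forms two parts; the opposite edge together with `K_{s-1}` is a clique.
  · refine PolarOn.of_colouring {x | x = .inr (.inr 2) ∨ x = .inr (.inr 3)} Finset.univ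
      (fun x => decide (x = .inr (.inr 2))) (by simpa using hs) (by simp) ?_ ?_
    · rintro _ hx (rfl | rfl) _ hy (rfl | rfl) <;> simp [join, cycleGraph_four_adj_iff]
    · have h4 : ∀ x y : Fin 4, x ≠ 2 → x ≠ 3 → y ≠ 2 → y ≠ 3 → x ≠ y → (cycleGraph 4).Adj x y := by
        decide
      rintro (x | x | x) hx hxA (y | y | y) hy hyA hxy
      any_goals exact absurd (congrArg Sum.inl (Subsingleton.elim _ v)) hx
      any_goals exact absurd (congrArg Sum.inl (Subsingleton.elim _ v)) hy
      · simpa [join] using hxy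
      · simp [join]
      · simp [join]
      · simp only [Set.mem_ofPred_eq, Sum.inr.injEq, not_or] at hxA hyA
        simpa [join] using h4 x y hxA.1 hxA.2 hyA.1 hyA.2 (by simpa using hxy)
  · refine PolarOn.of_colouring {x | x.isRight} (Finset.univ.erase (.inl v))
      (Sum.elim (fun _ => .inr true) (Sum.map id fun i => decide (i = 0 ∨ i = 2)))
      (by simp; omega) ?_ ?_ ?_
    · rintro (x | x | x) hx hxA <;> simp_all
    · rintro (x | x | x) hx hxA (y | y | y) hy hyA <;>
        simp_all [join, cycleGraph_four_adj_iff]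
    · rintro (x | x | x) hx hxA (y | y | y) hy hyA hxy <;> simp_all [join]
  · have h4 : ∀ v x y : Fin 4, x ≠ v → x ≠ v + 2 → y ≠ v → y ≠ v + 2 →
        ¬ (cycleGraph 4).Adj x y := by
      decide
    -- The isolated vertex and the two cycle neighbours of `v` are independent; the vertex opposite
    -- to `v` together with `K_{s-1}` is a clique.
    refine PolarOn.of_colouring {x | x.isLeft ∨ ∃ i, x = .inr (.inr i) ∧ i ≠ v + 2} {0}
      (fun _ => (0 : Fin 1)) (by simp; omega) (by simp) ?_ ?_
    · rintro (x | x | x) hx hxA (y | y | y) hy hyA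
      · simp [Subsingleton.elim x y]
      · simp
      · simp
      · simp
      · simp at hxA
      · simp at hxA
      · simp
      · simp at hyA
      · simp only [Set.mem_ofPred_eq, Sum.isLeft_inr, Bool.false_eq_true, false_or, Sum.inr.injEq,
          exists_eq_left', Set.mem_compl_iff, Set.mem_singleton_iff] at hxA hyA hx hy
        simpa [join] using h4 v x y hx hxA hy hyA
    · rintro (x | x | x) hx hxA (y | y | y) hy hyA hxy <;> simp_all [join]

theorem polarOn_succ_T3 (hs : 1 ≤ s) :
    PolarOn (K 1 ⊕g join (K (s - 1)) (cycleGraph 4)) (s + 1) Set.univ := by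
  refine PolarOn.of_colouring {x | x.isRight} Finset.univ
    (Sum.elim (fun _ => .inr true) (Sum.map id fun i => decide (i = 0 ∨ i = 2)))
    (by simp; omega) (by simp) ?_ ?_
  · rintro (x | x | x) hx hxA (y | y | y) hy hyA <;>
      simp_all [join, cycleGraph_four_adj_iff]
  · rintro (x | x | x) hx hxA (y | y | y) hy hyA hxy <;> simp_all [join]

/-! ### The three kinds of minimal obstructions -/

theorem IsEssentialCograph.not_polarOn (h : IsEssentialCograph G) : ¬ PolarOn G s Set.univ := by
  intro hp
  rcases h with ⟨⟨e⟩⟩ | ⟨⟨e⟩⟩ | ⟨⟨e⟩⟩ | ⟨⟨e⟩⟩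
  · exact not_polarOn_E1 (hp.of_embedding e.symm.toEmbedding)
  · exact not_polarOn_E2 (hp.of_embedding e.symm.toEmbedding)
  · exact not_polarOn_E3 (hp.of_embedding e.symm.toEmbedding)
  · exact not_polarOn_E7 (hp.of_embedding e.symm.toEmbedding)

theorem IsEssentialCograph.isMinimalPolarObstruction (hs : 2 ≤ s) (h : IsEssentialCograph G) :
    IsMinimalPolarObstruction s 1 G := by
  rcases h with ⟨⟨e⟩⟩ | ⟨⟨e⟩⟩ | ⟨⟨e⟩⟩ | ⟨⟨e⟩⟩
  · exact isMinimalPolarObstruction_of_iso e (isMinimalPolarObstruction_E1 hs)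
  · exact isMinimalPolarObstruction_of_iso e (isMinimalPolarObstruction_E2 hs)
  · exact isMinimalPolarObstruction_of_iso e (isMinimalPolarObstruction_E3 hs)
  · exact isMinimalPolarObstruction_of_iso e (isMinimalPolarObstruction_E7 hs)

theorem IsDisconnectedType.isMinimalPolarObstruction (hs : 2 ≤ s) (h : IsDisconnectedType s G) :
    IsMinimalPolarObstruction s 1 G := by
  rcases h with ⟨⟨e⟩⟩ | ⟨⟨e⟩⟩ | ⟨⟨e⟩⟩
  · exact isMinimalPolarObstruction_of_iso e isMinimalPolarObstruction_T1
  · exact isMinimalPolarObstruction_of_iso e (isMinimalPolarObstruction_T2 hs)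
  · exact isMinimalPolarObstruction_of_iso e (isMinimalPolarObstruction_T3 hs)

/-- One more part suffices here, whereas the essential cographs are polar for no number of parts.
This separates the two lists and feeds the join argument. -/
theorem IsDisconnectedType.polarOn_succ (hs : 1 ≤ s) (h : IsDisconnectedType s G) :
    PolarOn G (s + 1) Set.univ := by
  rcases h with ⟨⟨e⟩⟩ | ⟨⟨e⟩⟩ | ⟨⟨e⟩⟩
  · exact polarOn_succ_T1.of_embedding e.toEmbedding
  · exact polarOn_succ_T2.of_embedding e.toEmbedding
  · exact (polarOn_succ_T3 hs).of_embedding e.toEmbedding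

theorem not_preconnected_sum {W₁ W₂ : Type*} {H₁ : SimpleGraph W₁} {H₂ : SimpleGraph W₂}
    (w₁ : W₁) (w₂ : W₂) (e : G ≃g H₁ ⊕g H₂) : ¬ G.Preconnected := by
  rw [← cut_univ_iff]
  refine ⟨{x | (e x).isLeft}, ⟨e.symm (.inl w₁), trivial, by simp⟩,
    ⟨e.symm (.inr w₂), trivial, by simp⟩, ?_⟩
  intro x _ hx y _ hy hxy
  rw [← e.map_adj_iff] at hxy
  simp only [Set.mem_ofPred_eq] at hx hy
  revert hx hy hxy
  generalize e x = a
  generalize e y = b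
  rcases a with a | a <;> rcases b with b | b <;> simp

theorem IsEssentialCograph.not_preconnected (h : IsEssentialCograph G) : ¬ G.Preconnected := by
  rcases h with ⟨⟨e⟩⟩ | ⟨⟨e⟩⟩ | ⟨⟨e⟩⟩ | ⟨⟨e⟩⟩
  · exact not_preconnected_sum 0 (.inl 0) e
  · exact not_preconnected_sum 0 0 e
  · exact not_preconnected_sum 0 0 e
  · exact not_preconnected_sum 0 (.inl 0) e

theorem IsDisconnectedType.not_preconnected (h : IsDisconnectedType s G) : ¬ G.Preconnected := by
  rcases h with ⟨⟨e⟩⟩ | ⟨⟨e⟩⟩ | ⟨⟨e⟩⟩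
  · exact not_preconnected_sum 0 0 e
  · exact not_preconnected_sum 0 (.inr 0) e
  · exact not_preconnected_sum 0 (.inr 0) e

theorem IsMinimalPolarObstruction.of_not_preconnected [Finite V] (hG : Sparse G) (hs : 2 ≤ s)
    (h : IsMinimalPolarObstruction s 1 G) (hd : ¬ G.Preconnected) :
    IsEssentialCograph G ∨ IsDisconnectedType s G := by
  rcases exists_obstruction hG hd hs (isMinimalPolarObstruction_iff.1 h).1 with
    ⟨⟨φ⟩⟩ | ⟨⟨φ⟩⟩ | ⟨⟨φ⟩⟩ | ⟨⟨φ⟩⟩ | ⟨⟨φ⟩⟩ | ⟨⟨φ⟩⟩ | ⟨⟨φ⟩⟩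
  · exact Or.inl (Or.inl (h.nonempty_iso φ not_polarOn_E1))
  · exact Or.inl (Or.inr (Or.inl (h.nonempty_iso φ not_polarOn_E2)))
  · exact Or.inl (Or.inr (Or.inr (Or.inl (h.nonempty_iso φ not_polarOn_E3))))
  · exact Or.inl (Or.inr (Or.inr (Or.inr (h.nonempty_iso φ not_polarOn_E7))))
  · exact Or.inr (Or.inl (h.nonempty_iso φ not_polarOn_T1))
  · exact Or.inr (Or.inr (Or.inl (h.nonempty_iso φ not_polarOn_T2)))
  · exact Or.inr (Or.inr (Or.inr (h.nonempty_iso φ (not_polarOn_T3 (by omega)))))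

/-- A minimal `(s, 1)`-polar obstruction with connected complement is `(s + 1, 1)`-polar, unless
it is one of the four essential cographs. -/
theorem IsMinimalPolarObstruction.polarOn_succ [Finite V] (hG : Sparse G)
    (h : IsMinimalPolarObstruction s 1 G) (hc : Gᶜ.Preconnected) (he : ¬ IsEssentialCograph G) :
    PolarOn G (s + 1) Set.univ := by
  have hd : ¬ G.Preconnected := (h.not_preconnected_or hG).resolve_right (not_not.2 hc)
  have hp := (isMinimalPolarObstruction_iff.1 h).1
  -- Co-components may have a parameter below `2`. The obstruction is `2K₁` for `s = 0`, and `2K₂`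
  -- or `C₄` for `s = 1`.
  obtain rfl | rfl | hs : s = 0 ∨ s = 1 ∨ 2 ≤ s := by omega
  · obtain ⟨x, y, hxy, hne⟩ : ∃ x y, ¬ G.Adj x y ∧ x ≠ y := by
      by_contra! hn
      exact hp ⟨∅, fun _ => 0, by simp, by simp, fun x _ _ y _ _ hne => by
        by_contra hxy
        exact hne (hn x y hxy)⟩
    have hφ := (embedsIn_twoK1 hxy hne).nonempty
    obtain ⟨φ⟩ := hφ
    obtain ⟨e⟩ := h.nonempty_iso φ (by
      rintro ⟨A, f, h1, h2, h3⟩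
      have h0 : (0 : Fin 2) ∉ A := fun h0 => absurd (h1 0 trivial h0) (by omega)
      have h1' : (1 : Fin 2) ∉ A := fun h0 => absurd (h1 1 trivial h0) (by omega)
      exact h3 0 trivial h0 1 trivial h1' (by decide))
    refine PolarOn.of_embedding e.toEmbedding ⟨Set.univ, fun _ => 0, by simp, by simp, by simp⟩
  · rcases exists_2K2_or_C4_of_not_polarOn hG le_rfl hp with
      ⟨a, b, c, d, hab, hcd, hac, had, hbc, hbd⟩ |
      ⟨a, b, c, d, hab, hbc, hcd, hda, hac, hbd, hac', hbd'⟩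
    · have h1 : a ≠ c := by rintro rfl; exact hbc hab.symm
      have h2 : a ≠ d := by rintro rfl; exact hbd hab.symm
      have h3 : b ≠ c := by rintro rfl; exact hac hab
      have h4 : b ≠ d := by rintro rfl; exact had hab
      obtain ⟨φ⟩ : Nonempty (K (1 + 1) ⊕g K (1 + 1) ↪g G) :=
        ((embedsIn_K2 hab).sum (embedsIn_K2 hcd) (by simp [*])).nonempty
      obtain ⟨e⟩ := h.nonempty_iso φ not_polarOn_T1
      exact polarOn_succ_T1.of_embedding e.toEmbedding
    · obtain ⟨φ⟩ := (embedsIn_C4 hab hbc hcd hda hac hbd hac' hbd').nonempty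
      obtain ⟨e⟩ := h.nonempty_iso φ (fun h => not_split_of_C4 (a := (0 : Fin 4)) (b := 1) (c := 2)
        (d := 3) (by decide) (by decide) (by decide) (by decide) (by decide) (by decide)
        (by decide) (by decide) h.split_of_one)
      refine PolarOn.of_embedding e.toEmbedding (PolarOn.of_colouring Set.univ Finset.univ
        (fun i : Fin 4 => decide (i = 0 ∨ i = 2)) (by simp) (fun _ _ _ => Finset.mem_univ _) ?_
        (by simp))
      intro x _ _ y _ _
      exact cycleGraph_four_adj_iff x y
  · rcases h.of_not_preconnected hG hs hd with h' | h'
    · exact absurd h' he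
    · exact h'.polarOn_succ (by omega)

theorem not_sparse_of {a b c d x : V} (h : IsP4 G a b c d) (hx : x ≠ a ∧ x ≠ b ∧ x ≠ c ∧ x ≠ d)
    (h' : G.Adj x a ∧ ¬ G.Adj x b ∨ G.Adj x d ∧ ¬ G.Adj x c ∨ G.Adj x a ∧ ¬ G.Adj x c ∨
      G.Adj x c ∧ ¬ G.Adj x b) : ¬ Sparse G := by
  intro hG
  have := hG a b c d x h hx.1 hx.2.1 hx.2.2.1 hx.2.2.2
  tauto

/-- The other three essential graphs contain `C₅`, the banner or the complement of `P₅`, in each of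
which, or in its complement, a fifth vertex violates the condition on a `P₄`. -/
theorem Sparse.not_isEssential (hG : Sparse G) (he : ¬ IsEssentialCograph G) :
    ¬ IsEssential G := by
  rintro (h | ⟨⟨e⟩⟩ | ⟨⟨e⟩⟩ | ⟨⟨e⟩⟩)
  · exact he h
  · have h := hG.comap (H := cycleGraph 5) (e.symm.toEmbedding.comp Embedding.sumInr)
    revert h
    exact not_sparse_of (a := 0) (b := 1) (c := 2) (d := 3) (x := 4) (by unfold IsP4; decide)
      (by decide) (by decide)
  · have h := hG.comap (H := banner) (e.symm.toEmbedding.comp Embedding.sumInr)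
    revert h
    exact not_sparse_of (a := 4) (b := 2) (c := 1) (d := 0) (x := 3) (by unfold IsP4; decide)
      (by decide) (by decide)
  · have h := (hG.comap (H := (pathGraph 5)ᶜ) (e.symm.toEmbedding.comp Embedding.sumInr)).compl
    rw [compl_compl] at h
    revert h
    exact not_sparse_of (a := 0) (b := 1) (c := 2) (d := 3) (x := 4) (by unfold IsP4; decide)
      (by decide) (by decide)

/-! ### Graphs with disconnected complement -/

theorem polarOn_induce_iff {U : Set V} : PolarOn (G.induce U) s Set.univ ↔ PolarOn G s U := by
  rw [← isPolar_iff_polarOn_univ, isPolar_induce_iff]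

theorem isMinimalPolarObstruction_induce_iff {U : Set V} :
    IsMinimalPolarObstruction s 1 (G.induce U) ↔
      ¬ PolarOn G s U ∧ ∀ v ∈ U, PolarOn G s (U \ {v}) := by
  have himg : ∀ v : U, (Embedding.induce U : G.induce U ↪g G) '' {v}ᶜ = U \ {↑v} := by
    intro v
    ext x
    simp [Subtype.ext_iff, and_comm]
  constructor
  · intro h
    refine ⟨fun hp => (isMinimalPolarObstruction_iff.1 h).1 (polarOn_induce_iff.2 hp),
      fun v hv => ?_⟩
    rw [← himg ⟨v, hv⟩, polarOn_image_iff]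
    exact h.polarOn_of_notMem (v := ⟨v, hv⟩) (by simp)
  · rintro ⟨h1, h2⟩
    refine isMinimalPolarObstruction_of_delete (fun hp => h1 (polarOn_induce_iff.1 hp)) fun v => ?_
    rw [← polarOn_image_iff (Embedding.induce U : G.induce U ↪g G), himg]
    exact h2 v v.2

theorem compl_toSimpleGraph (D : Gᶜ.ConnectedComponent) :
    D.toSimpleGraphᶜ = G.induce D.supp := by
  rw [← compl_compl (G.induce D.supp), ← induce_compl_eq]
  rfl

theorem isMinimalPolarObstruction_component_iff (D : Gᶜ.ConnectedComponent) :
    IsMinimalPolarObstruction 1 s D.toSimpleGraph ↔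
      ¬ PolarOn G s D.supp ∧ ∀ v ∈ D.supp, PolarOn G s (D.supp \ {v}) := by
  rw [← isMinimalPolarObstruction_induce_iff, ← compl_toSimpleGraph]
  exact isMinimalPolarObstruction_compl_iff.symm

theorem polarOn_succ_component [Finite V] (hG : Sparse G) (D : Gᶜ.ConnectedComponent)
    (h : IsMinimalPolarObstruction 1 s D.toSimpleGraph)
    (he : ¬ IsEssentialCograph (G.induce D.supp)) : PolarOn G (s + 1) D.supp := by
  rw [isMinimalPolarObstruction_component_iff, ← isMinimalPolarObstruction_induce_iff] at h
  refine polarOn_induce_iff.1 (h.polarOn_succ (hG.comap (Embedding.induce _)) ?_ he)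
  rw [← induce_compl_eq]
  exact D.connected_toSimpleGraph.preconnected

section Components

variable {t : ℕ} (C : Fin t ≃ Gᶜ.ConnectedComponent)

theorem component_preimage (i : Fin t) :
    (fun x => C.symm (Gᶜ.connectedComponentMk x)) ⁻¹' {i} = (C i).supp := by
  ext x
  simp [Equiv.symm_apply_eq]

theorem adj_of_component_ne (x y : V) (h : C.symm (Gᶜ.connectedComponentMk x) ≠
    C.symm (Gᶜ.connectedComponentMk y)) : G.Adj x y := by
  by_contra hn
  have hxy : x ≠ y := by rintro rfl; exact h rfl
  have : Gᶜ.Adj x y := (compl_adj _ _ _).2 ⟨hxy, hn⟩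
  exact h (congrArg _ (ConnectedComponent.eq.2 this.reachable))

theorem PolarOn.of_components {W : Set V} (m : Fin t → ℕ)
    (h : ∀ i, PolarOn G (m i) (W ∩ (C i).supp)) : PolarOn G (∑ i, m i) W :=
  PolarOn.join _ (adj_of_component_ne C) W m fun i => by
    rw [component_preimage]
    exact h i

theorem PolarOn.exists_components [Finite V] {W : Set V} (h : PolarOn G s W) :
    ∃ m : Fin t → ℕ, ∑ i, m i ≤ s ∧ ∀ i, PolarOn G (m i) (W ∩ (C i).supp) := by
  obtain ⟨m, h1, h2⟩ := h.exists_of_join _ (adj_of_component_ne C)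
  refine ⟨m, h1, fun i => ?_⟩
  rw [← component_preimage]
  exact h2 i

/-- The factor `C i` needs exactly `σ i + 1` parts, for a total of `s + 1`. Deleting a vertex saves
one part in its own factor. -/
theorem isMinimalPolarObstruction_of_components [Finite V] (hG : Sparse G) (σ : Fin t → ℕ)
    (h : ∀ i, IsMinimalPolarObstruction 1 (σ i) (C i).toSimpleGraph ∧
      ¬ IsEssential (C i).toSimpleGraphᶜ) (hs : (s : ℤ) = t - 1 + ∑ i, (σ i : ℤ)) :
    IsMinimalPolarObstruction s 1 G := by
  have hs' : ∑ i, (σ i + 1) = s + 1 := by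
    have : ((∑ i, (σ i + 1) : ℕ) : ℤ) = ((s + 1 : ℕ) : ℤ) := by
      push_cast
      rw [hs, Finset.sum_add_distrib]
      simp
      ring
    exact_mod_cast this
  have hpolar : ∀ i, PolarOn G (σ i + 1) (C i).supp := fun i =>
    polarOn_succ_component hG (C i) (h i).1 fun he =>
      (h i).2 (Or.inl (by rw [compl_toSimpleGraph]; exact he))
  have hmin := fun i => (isMinimalPolarObstruction_component_iff (C i)).1 (h i).1
  refine isMinimalPolarObstruction_of_delete ?_ fun v => ?_
  · intro hp
    obtain ⟨m, hm, hm'⟩ := hp.exists_components C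
    have : ∑ i, (σ i + 1) ≤ ∑ i, m i := Finset.sum_le_sum fun i _ => by
      by_contra hlt
      exact (hmin i).1 (((hm' i).mono (by simp)).mono_right (by omega))
    omega
  · let j := C.symm (Gᶜ.connectedComponentMk v)
    have hj : v ∈ (C j).supp := by simp [j]
    have hsum : ∑ i, (if i = j then σ i else σ i + 1) = s := by
      have h1 := Finset.add_sum_erase Finset.univ (fun i => σ i + 1) (Finset.mem_univ j)
      have h2 := Finset.add_sum_erase Finset.univ (fun i => if i = j then σ i else σ i + 1)
        (Finset.mem_univ j)
      have h3 : ∑ i ∈ Finset.univ.erase j, (if i = j then σ i else σ i + 1) =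
          ∑ i ∈ Finset.univ.erase j, (σ i + 1) :=
        Finset.sum_congr rfl fun i hi => if_neg (Finset.ne_of_mem_erase hi)
      simp only [if_true] at h1 h2
      omega
    rw [← hsum]
    refine PolarOn.of_components C _ fun i => ?_
    split_ifs with hij
    · rw [hij]
      exact ((hmin j).2 v hj).mono fun x hx => ⟨hx.2, hx.1⟩
    · exact (hpolar i).mono Set.inter_subset_right

theorem IsMinimalPolarObstruction.exists_components [Finite V] (hG : Sparse G)
    (h : IsMinimalPolarObstruction s 1 G) (hd : ¬ Gᶜ.Preconnected) :
    ∃ σ : Fin t → ℕ, (∀ i, IsMinimalPolarObstruction 1 (σ i) (C i).toSimpleGraph ∧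
      ¬ IsEssential (C i).toSimpleGraphᶜ) ∧ (s : ℤ) = t - 1 + ∑ i, (σ i : ℤ) := by
  classical
  have hproper : ∀ i, ∃ v, v ∉ (C i).supp := by
    intro i
    by_contra! hn
    exact hd fun x y => (C i).reachable_of_mem_supp (hn x) (hn y)
  have hs : ∀ i, PolarOn G s (C i).supp := fun i =>
    (hproper i).elim fun v hv => h.polarOn_of_notMem hv
  have hex : ∀ i, ∃ r, PolarOn G r (C i).supp := fun i => ⟨s, hs i⟩
  let m : Fin t → ℕ := fun i => Nat.find (hex i)
  have hm : ∀ i, PolarOn G (m i) (C i).supp := fun i => Nat.find_spec (hex i)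
  have hm' : ∀ i r, PolarOn G r (C i).supp → m i ≤ r := fun i r hr => Nat.find_min' (hex i) hr
  have hes : ∀ i, ¬ IsEssentialCograph (G.induce (C i).supp) := fun i he =>
    he.not_polarOn (polarOn_induce_iff.2 (hs i))
  have hlarge : s + 1 ≤ ∑ i, m i := by
    by_contra hlt
    refine (isMinimalPolarObstruction_iff.1 h).1 (PolarOn.mono_right
      (PolarOn.of_components C m fun i => (hm i).mono Set.inter_subset_right) (by omega))
  -- After `v` is deleted, the other factors still use at least `m j` parts each, which bounds what
  -- is left for factor `i`.
  have hdel : ∀ i, ∀ v ∈ (C i).supp, ∃ r, PolarOn G r ((C i).supp \ {v}) ∧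
      r + ∑ j, m j ≤ s + m i := by
    intro i v hv
    obtain ⟨m', h1, h2⟩ := (h.polarOn_of_notMem (W := {v}ᶜ) (v := v)
      (by simp)).exists_components C
    refine ⟨m' i, (h2 i).mono fun x hx => ⟨hx.2, hx.1⟩, ?_⟩
    have h3 := Finset.add_sum_erase Finset.univ m (Finset.mem_univ i)
    have h4 := Finset.add_sum_erase Finset.univ m' (Finset.mem_univ i)
    have h5 : ∑ j ∈ Finset.univ.erase i, m j ≤ ∑ j ∈ Finset.univ.erase i, m' j := by
      refine Finset.sum_le_sum fun j hj => hm' j _ ((h2 j).mono fun x hx => ⟨?_, hx⟩)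
      rintro rfl
      refine Finset.ne_of_mem_erase hj (C.injective ?_)
      rw [ConnectedComponent.mem_supp_iff] at hv hx
      rw [← hv, ← hx]
    omega
  have hne : ∀ i, ∃ v, v ∈ (C i).supp := fun i => (C i).nonempty_supp
  -- In this range, `r` parts are too few for the factor but enough after any deletion.
  have hmin : ∀ i r, r < m i → s + m i ≤ r + ∑ j, m j →
      IsMinimalPolarObstruction 1 r (C i).toSimpleGraph := by
    intro i r hr hr'
    rw [isMinimalPolarObstruction_component_iff]
    refine ⟨fun hp => absurd (hm' i r hp) (by omega), fun v hv => ?_⟩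
    obtain ⟨q, hq, hq'⟩ := hdel i v hv
    exact hq.mono_right (by omega)
  have hpos : ∀ i, 1 ≤ m i := by
    intro i
    obtain ⟨v, hv⟩ := hne i
    obtain ⟨q, -, hq⟩ := hdel i v hv
    omega
  have hsum : ∑ i, m i = s + 1 := by
    by_contra hn
    obtain ⟨i⟩ : Nonempty (Fin t) := by
      by_contra hemp
      rw [not_nonempty_iff] at hemp
      simp at hlarge
    obtain ⟨v, hv⟩ := hne i
    obtain ⟨q, -, hq⟩ := hdel i v hv
    -- If the sum were at least `s + 2`, the factor would also be a minimal obstruction for `m i -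
    -- 2`. One extra part would then suffice, and `m i - 1` would contradict the choice of `m i`.
    have h2 : 2 ≤ m i := by omega
    have := hm' i _ (polarOn_succ_component hG (C i) (hmin i (m i - 2) (by omega) (by omega))
      (hes i))
    omega
  refine ⟨fun i => m i - 1, fun i => ⟨hmin i (m i - 1) (by have := hpos i; omega)
    (by have := hpos i; omega), ?_⟩, ?_⟩
  · rw [compl_toSimpleGraph]
    exact (hG.comap (Embedding.induce _)).not_isEssential (hes i)
  · have h1 : ∑ i, ((m i - 1 : ℕ) : ℤ) = ∑ i, ((m i : ℤ) - 1) :=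
      Finset.sum_congr rfl fun i _ => by
        have := hpos i
        push_cast [this]
        ring
    have h2 : ∑ i, (m i : ℤ) = s + 1 := by exact_mod_cast hsum
    rw [h1, Finset.sum_sub_distrib, h2]
    simp

end Components

theorem isMinimalPolarObstruction_iff_isRecursiveType [Finite V] (hG : Sparse G)
    (hd : ¬ Gᶜ.Preconnected) : IsMinimalPolarObstruction s 1 G ↔ IsRecursiveType s G := by
  constructor
  · intro h
    obtain ⟨n, ⟨e⟩⟩ := Finite.exists_equiv_fin Gᶜ.ConnectedComponent
    exact ⟨hd, n, e.symm, h.exists_components e.symm hG hd⟩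
  · rintro ⟨-, t, C, σ, h, hs⟩
    exact isMinimalPolarObstruction_of_components C hG σ h hs

end PolarObs

theorem mainTheorem4 {V : Type*} [Finite V] (G : SimpleGraph V) (hG : PolarObs.IsP4Sparse G)
    (s : ℕ) (hs : 2 ≤ s) :
    PolarObs.IsMinimalPolarObstruction s 1 G ↔
      PolarObs.ExactlyOne (PolarObs.IsEssentialCograph G) (PolarObs.IsDisconnectedType s G)
        (PolarObs.IsRecursiveType s G) := by
  have hS := hG.sparse
  have h12 : PolarObs.IsEssentialCograph G → ¬ PolarObs.IsDisconnectedType s G := fun h h' =>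
    h.not_polarOn (h'.polarOn_succ (by omega))
  -- The first two types are disconnected and the third is co-disconnected, which is impossible
  -- together; this gives exclusivity with the third type.
  have hcompl : ¬ G.Preconnected → Gᶜ.Preconnected := fun h =>
    G.connected_or_preconnected_compl.resolve_left fun h' => h h'.preconnected
  have h13 : PolarObs.IsEssentialCograph G → ¬ PolarObs.IsRecursiveType s G := fun h h' =>
    h'.1 (hcompl h.not_preconnected)
  have h23 : PolarObs.IsDisconnectedType s G → ¬ PolarObs.IsRecursiveType s G := fun h h' =>
    h'.1 (hcompl h.not_preconnected)
  have key : PolarObs.IsMinimalPolarObstruction s 1 G ↔ PolarObs.IsEssentialCograph G ∨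
      PolarObs.IsDisconnectedType s G ∨ PolarObs.IsRecursiveType s G := by
    constructor
    · intro h
      rcases h.not_preconnected_or hS with hd | hd
      · rcases h.of_not_preconnected hS hs hd with h' | h'
        · exact Or.inl h'
        · exact Or.inr (Or.inl h')
      · exact Or.inr (Or.inr
          ((PolarObs.isMinimalPolarObstruction_iff_isRecursiveType hS hd).1 h))
    · rintro (h | h | h)
      · exact h.isMinimalPolarObstruction hs
      · exact h.isMinimalPolarObstruction hs
      · exact (PolarObs.isMinimalPolarObstruction_iff_isRecursiveType hS h.1).2 h
  rw [key, PolarObs.ExactlyOne]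
  tauto
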